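/- Let $\mathbb K$ be an algebraically closed field of characteristic different from $2$ (i.e. of good characteristic for the ortho-symplectic Lie superalgebras; characteristic $0$ is allowed). Let $V=V_{\bar 0}\oplus V_{\bar 1}$ be a finite-dimensional vector superspace over $\mathbb K$ with a non-degenerate even supersymmetric bilinear form $B$: $V_{\bar 0}\perp V_{\bar 1}$, $B|_{V_{\bar 0}}$ is symmetric and $B|_{V_{\bar 1}}$ is skew-symmetric. Write $m=\dim V_{\bar 0}$, $2n=\dim V_{\bar 1}$, and let $\mathfrak g=\mathfrak{osp}(V)=\mathfrak{osp}(m|2n)=\mathfrak g_{\bar 0}\oplus\mathfrak g_{\bar 1}$, where $$\mathfrak g_{c}=\{x\in\mathfrak{gl}(V)_{c}: B(xu,w)=-(-1)^{c\,\bar u}B(u,xw)\ \text{for all homogeneous } u,w\in V\}.$$ Let $e\in\mathfrak g_{\bar 0}$ be nilpotent and $\mathfrak g^e=\{x\in\mathfrak g:[e,x]=0\}$. (a) Let $\lambda=(\lambda_1\ge\dots\ge\lambda_N)$, $\lambda_i\geq 1$, be the Jordan type of $e$, where each index $i$ has a parity $\bar i\in\{\bar 0,\bar 1\}$ and, among equal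 parts, the even ones precede the odd ones. There exist an involution $i\mapsto i^*$ of $\{1,\dots,N\}$ with $i^*\in\{i-1,i,i+1\}$, $\lambda_{i^*}=\lambda_i$, $\overline{i^*}=\bar i$, and with $i^*=i$ whenever $\bar i=\bar 0$ and $\lambda_i$ is odd, or $\bar i=\bar 1$ and $\lambda_i$ is even; vectors $v_1,\dots,v_N\in V$ such that the $e^kv_i$ with $0\le k<\lambda_i$, $\bar i=c$ form a basis of $V_c$ for each $c\in\{\bar 0,\bar 1\}$ and $e^{\lambda_i}v_i=0$; and signs $\theta_1,\dots,\theta_N\in\{\pm1\}$ such that, for $0\le a<\lambda_i$ and $0\le b<\lambda_j$, $B(e^av_i,e^bv_j)=(-1)^a\theta_i$ if $j=i^*$ and $a+b=\lambda_i-1$, and $B(e^av_i,e^bv_j)=0$ otherwise. (b) Fix any data as in (a). For $\max\{\lambda_j-\lambda_i,0\}\le k\le\lambda_j-1$ let $\xi_i^{j,k}\in\mathfrak{gl}(V)$ be the endomorphism commuting with $e$ and satisfying $\xi_i^{j,k}(v_t)=\delta_{it}e^kv_j$. Put $\varepsilon_{i,j,k}=(-1)^{\lambda_j-k-\bar x\,\bar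 i}\,\theta_j\theta_i$, where $\bar x=\bar i+\bar j$ is the parity of $\xi_i^{j,\lambda_j-1-k}$, and $$S_0=\{\xi_i^{i^*,\lambda_i-1-k}:0\le k\le\lambda_i-1,\ \bar i=\bar 0,\ k\text{ odd}\},\qquad S_1=\{\xi_i^{i^*,\lambda_i-1-k}:0\le k\le\lambda_i-1,\ \bar i=\bar 1,\ k\text{ even}\},$$ $$S_2=\{y_{i,j,k}:0\le k\le\min\{\lambda_i,\lambda_j\}-1,\ i^*\ne j\},\qquad y_{i,j,k}=\xi_i^{j,\lambda_j-1-k}+\varepsilon_{i,j,k}\,\xi_{j^*}^{i^*,\lambda_i-1-k}.$$ Then $S=S_0\cup S_1\cup S_2$ spans $\mathfrak g^e$. The map $(i,j,k)\mapsto(j^*,i^*,k)$ is a fixed-point-free involution of the set of indices of $S_2$, and $y_{j^*,i^*,k}=\varepsilon_{i,j,k}\,y_{i,j,k}$. If in $S_2$ one keeps the element of exactly one index of each pair $\{(i,j,k),(j^*,i^*,k)\}$ (chosen arbitrarily), then the resulting family $S$, indexed by the pairs $(i,k)$ of $S_0$ and $S_1$ and the chosen triples, is a basis of $\mathfrak g^e$.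 -/

import Mathlib

open Module

/-- An even supersymmetric bilinear form on the superspace `V = V₀ ⊕ V₁`: the two homogeneous parts
are orthogonal, the form is symmetric on `V₀` and skew-symmetric on `V₁`. -/
structure IsEvenSupersymmetric {K V : Type*} [Field K] [AddCommGroup V] [Module K V]
    (𝒱 : ZMod 2 → Submodule K V) (B : LinearMap.BilinForm K V) : Prop where
  orthogonal : ∀ c d : ZMod 2, c ≠ d → ∀ x ∈ 𝒱 c, ∀ y ∈ 𝒱 d, B x y = 0
  symm_even : ∀ x ∈ 𝒱 0, ∀ y ∈ 𝒱 0, B x y = B y x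
  skew_odd : ∀ x ∈ 𝒱 1, ∀ y ∈ 𝒱 1, B x y = -B y x

/-- `gl(V)_c`: the endomorphisms of `V` that are homogeneous of parity `c`. -/
def glPart {K V : Type*} [Field K] [AddCommGroup V] [Module K V]
    (𝒱 : ZMod 2 → Submodule K V) (c : ZMod 2) : Submodule K (End K V) where
  carrier := {x | ∀ d : ZMod 2, ∀ v ∈ 𝒱 d, x v ∈ 𝒱 (c + d)}
  add_mem' hx hy d v hv := (𝒱 (c + d)).add_mem (hx d v hv) (hy d v hv)
  zero_mem' d _ _ := (𝒱 (c + d)).zero_mem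
  smul_mem' a _ hx d v hv := (𝒱 (c + d)).smul_mem a (hx d v hv)

/-- `osp(V)_c`: the `x ∈ gl(V)_c` with `B(x v, w) = -(-1)^{c |v|} B(v, x w)` for homogeneous
`v`, `w`. -/
def ospPart {K V : Type*} [Field K] [AddCommGroup V] [Module K V]
    (𝒱 : ZMod 2 → Submodule K V) (B : LinearMap.BilinForm K V) (c : ZMod 2) :
    Submodule K (End K V) where
  carrier := {x | x ∈ glPart 𝒱 c ∧ ∀ d d' : ZMod 2, ∀ v ∈ 𝒱 d, ∀ w ∈ 𝒱 d',
    B (x v) w = -((-1 : K) ^ (c.val * d.val) * B v (x w))}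
  add_mem' := by
    rintro x y ⟨hx, hx'⟩ ⟨hy, hy'⟩
    refine ⟨add_mem hx hy, fun d d' v hv w hw => ?_⟩
    simp only [LinearMap.add_apply, map_add, hx' d d' v hv w hw, hy' d d' v hv w hw]
    ring
  zero_mem' := ⟨zero_mem _, fun d d' v _ w _ => by simp⟩
  smul_mem' := by
    rintro a x ⟨hx, hx'⟩
    refine ⟨Submodule.smul_mem _ a hx, fun d d' v hv w hw => ?_⟩
    simp only [LinearMap.smul_apply, map_smul, hx' d d' v hv w hw, smul_eq_mul]
    ring

/-- The ortho-symplectic Lie superalgebra `osp(V) = osp(V)₀ ⊕ osp(V)₁`, as a subspace of `End V`. -/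
def osp {K V : Type*} [Field K] [AddCommGroup V] [Module K V]
    (𝒱 : ZMod 2 → Submodule K V) (B : LinearMap.BilinForm K V) : Submodule K (End K V) :=
  ospPart 𝒱 B 0 ⊔ ospPart 𝒱 B 1

/-- The projection of `V = V₀ ⊕ V₁` onto its homogeneous part `V_c`. -/
noncomputable def superProj {K V : Type*} [Field K] [AddCommGroup V] [Module K V]
    (𝒱 : ZMod 2 → Submodule K V) [DirectSum.Decomposition 𝒱] (c : ZMod 2) : End K V :=
  (𝒱 c).subtype ∘ₗ DirectSum.component K (ZMod 2) (fun d => 𝒱 d) c ∘ₗ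
    (DirectSum.decomposeLinearEquiv 𝒱).toLinearMap

/-- The component of parity `c` of an endomorphism of `V`. -/
noncomputable def parityPart {K V : Type*} [Field K] [AddCommGroup V] [Module K V]
    (𝒱 : ZMod 2 → Submodule K V) [DirectSum.Decomposition 𝒱] (c : ZMod 2) (x : End K V) :
    End K V :=
  ∑ d : ZMod 2, superProj 𝒱 (c + d) * x * superProj 𝒱 d

/-- The superbracket of `gl(V)`: `[x, y] = x y - (-1)^{|x| |y|} y x` for homogeneous `x`, `y`,
extended bilinearly. -/
noncomputable def superBracket {K V : Type*} [Field K] [AddCommGroup V] [Module K V]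
    (𝒱 : ZMod 2 → Submodule K V) [DirectSum.Decomposition 𝒱] (x y : End K V) : End K V :=
  ∑ a : ZMod 2, ∑ b : ZMod 2, (parityPart 𝒱 a x * parityPart 𝒱 b y
    - (-1 : K) ^ (a.val * b.val) • (parityPart 𝒱 b y * parityPart 𝒱 a x))

theorem parityPart_add {K V : Type*} [Field K] [AddCommGroup V] [Module K V]
    (𝒱 : ZMod 2 → Submodule K V) [DirectSum.Decomposition 𝒱] (c : ZMod 2) (x y : End K V) :
    parityPart 𝒱 c (x + y) = parityPart 𝒱 c x + parityPart 𝒱 c y := by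
  simp only [parityPart, mul_add, add_mul, Finset.sum_add_distrib]

theorem parityPart_smul {K V : Type*} [Field K] [AddCommGroup V] [Module K V]
    (𝒱 : ZMod 2 → Submodule K V) [DirectSum.Decomposition 𝒱] (c : ZMod 2) (a : K) (x : End K V) :
    parityPart 𝒱 c (a • x) = a • parityPart 𝒱 c x := by
  simp only [parityPart, mul_smul_comm, smul_mul_assoc, Finset.smul_sum]

theorem superBracket_add {K V : Type*} [Field K] [AddCommGroup V] [Module K V]
    (𝒱 : ZMod 2 → Submodule K V) [DirectSum.Decomposition 𝒱] (x y z : End K V) :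
    superBracket 𝒱 x (y + z) = superBracket 𝒱 x y + superBracket 𝒱 x z := by
  simp only [superBracket, parityPart_add, mul_add, add_mul, smul_add, ← Finset.sum_add_distrib]
  refine Finset.sum_congr rfl fun a _ => Finset.sum_congr rfl fun b _ => ?_
  abel

theorem superBracket_smul {K V : Type*} [Field K] [AddCommGroup V] [Module K V]
    (𝒱 : ZMod 2 → Submodule K V) [DirectSum.Decomposition 𝒱] (x : End K V) (a : K)
    (y : End K V) : superBracket 𝒱 x (a • y) = a • superBracket 𝒱 x y := by
  simp only [superBracket, parityPart_smul, mul_smul_comm, smul_mul_assoc, Finset.smul_sum,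
    smul_sub]
  refine Finset.sum_congr rfl fun b _ => Finset.sum_congr rfl fun c _ => ?_
  rw [smul_comm a]

/-- The centralizer `𝔤^e = {x ∈ 𝔤 : [e, x] = 0}` for `𝔤 = osp(V)`. -/
noncomputable def ospCentralizer {K V : Type*} [Field K] [AddCommGroup V] [Module K V]
    (𝒱 : ZMod 2 → Submodule K V) [DirectSum.Decomposition 𝒱] (B : LinearMap.BilinForm K V)
    (e : End K V) : Submodule K (End K V) where
  carrier := {x | x ∈ osp 𝒱 B ∧ superBracket 𝒱 e x = 0}
  add_mem' := by
    rintro x y ⟨hx, hx'⟩ ⟨hy, hy'⟩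
    exact ⟨add_mem hx hy, by rw [superBracket_add, hx', hy', add_zero]⟩
  zero_mem' := ⟨zero_mem _, by
    have h := superBracket_smul 𝒱 e (0 : K) 0
    rwa [zero_smul, zero_smul] at h⟩
  smul_mem' := by
    rintro a x ⟨hx, hx'⟩
    exact ⟨Submodule.smul_mem _ a hx, by rw [superBracket_smul, hx', smul_zero]⟩

/-- The Jordan type `λ = (λ_1, …, λ_N)` of `e`, with the parities `par i` of its parts, together with
Jordan strings `v_i, e v_i, …, e^{λ_i - 1} v_i` spanning `V₀` and `V₁` that are adapted to the
form `B`: `star` is the involution `i ↦ i*` pairing the strings, and `θ_i` are the signs with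
`B(e^a v_i, e^{λ_i - 1 - a} v_{i*}) = (-1)^a θ_i`, all other values of `B` being zero. -/
structure OspJordanData {K V : Type*} [Field K] [AddCommGroup V] [Module K V]
    (𝒱 : ZMod 2 → Submodule K V) (B : LinearMap.BilinForm K V) (e : End K V) (N : ℕ) where
  lam : Fin N → ℕ
  par : Fin N → ZMod 2
  v : Fin N → V
  star : Fin N → Fin N
  theta : Fin N → ℤˣ
  lam_pos : ∀ i, 0 < lam i
  lam_antitone : Antitone lam
  even_before_odd : ∀ i j, lam i = lam j → par i = 0 → par j = 1 → i < j
  linearIndependent : LinearIndependent K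
    (fun p : (i : Fin N) × Fin (lam i) => (e ^ (p.2 : ℕ)) (v p.1))
  span_part : ∀ c : ZMod 2,
    Submodule.span K {x : V | ∃ i, par i = c ∧ ∃ k < lam i, x = (e ^ k) (v i)} = 𝒱 c
  pow_lam : ∀ i, (e ^ lam i) (v i) = 0
  star_star : ∀ i, star (star i) = i
  star_near : ∀ i j, star i = j → (i : ℕ) ≤ (j : ℕ) + 1 ∧ (j : ℕ) ≤ (i : ℕ) + 1
  lam_star : ∀ i, lam (star i) = lam i
  par_star : ∀ i, par (star i) = par i
  star_eq_of_even : ∀ i, par i = 0 → Odd (lam i) → star i = i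
  star_eq_of_odd : ∀ i, par i = 1 → Even (lam i) → star i = i
  form_eq : ∀ i j a b, a < lam i → b < lam j →
    B ((e ^ a) (v i)) ((e ^ b) (v j)) =
      if j = star i ∧ a + b + 1 = lam i then (-1 : K) ^ a * ((theta i : ℤ) : K) else 0

namespace OspJordanData

theorem top_le_span {K V : Type*} [Field K] [AddCommGroup V] [Module K V]
    {𝒱 : ZMod 2 → Submodule K V} [DirectSum.Decomposition 𝒱] {B : LinearMap.BilinForm K V}
    {e : End K V} {N : ℕ} (D : OspJordanData 𝒱 B e N) :
    ⊤ ≤ Submodule.span K (Set.range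
      (fun p : (i : Fin N) × Fin (D.lam i) => (e ^ (p.2 : ℕ)) (D.v p.1))) := by
  rw [← (DirectSum.Decomposition.isInternal 𝒱).submodule_iSup_eq_top]
  refine iSup_le fun c => ?_
  rw [← D.span_part c]
  refine Submodule.span_mono ?_
  rintro x ⟨i, _, k, hk, rfl⟩
  exact ⟨⟨i, ⟨k, hk⟩⟩, rfl⟩

/-- The basis `e^a v_i` (`0 ≤ a < λ_i`) of `V`. -/
noncomputable def basis {K V : Type*} [Field K] [AddCommGroup V] [Module K V]
    {𝒱 : ZMod 2 → Submodule K V} [DirectSum.Decomposition 𝒱] {B : LinearMap.BilinForm K V}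
    {e : End K V} {N : ℕ} (D : OspJordanData 𝒱 B e N) :
    Basis ((i : Fin N) × Fin (D.lam i)) K V :=
  Basis.mk D.linearIndependent D.top_le_span

/-- `ξ_i^{j,k}`, the endomorphism with `ξ_i^{j,k}(v_t) = δ_{it} e^k v_j`, extended along the Jordan
strings by `ξ_i^{j,k}(e^a v_t) = e^a ξ_i^{j,k}(v_t)`. -/
noncomputable def xi {K V : Type*} [Field K] [AddCommGroup V] [Module K V]
    {𝒱 : ZMod 2 → Submodule K V} [DirectSum.Decomposition 𝒱] {B : LinearMap.BilinForm K V}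
    {e : End K V} {N : ℕ} (D : OspJordanData 𝒱 B e N) (i j : Fin N) (k : ℕ) : End K V :=
  D.basis.constr K (fun p => if p.1 = i then (e ^ (p.2 : ℕ)) ((e ^ k) (D.v j)) else 0)

/-- The sign `ε_{i,j,k} = (-1)^{λ_j - k - |x| |i|} θ_j θ_i`, where `|x| = |i| + |j|` is the parity of
`ξ_i^{j, λ_j - 1 - k}`. -/
def eps {K V : Type*} [Field K] [AddCommGroup V] [Module K V]
    {𝒱 : ZMod 2 → Submodule K V} {B : LinearMap.BilinForm K V}
    {e : End K V} {N : ℕ} (D : OspJordanData 𝒱 B e N) (i j : Fin N) (k : ℕ) : ℤˣ :=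
  (-1) ^ ((D.lam j : ℤ) - (k : ℤ) - ((D.par i + D.par j).val * (D.par i).val : ℕ))
    * D.theta j * D.theta i

/-- The pairs `(i, k)` with `0 ≤ k ≤ λ_i - 1`, `|i| = 0` and `k` odd. -/
def idx0 {K V : Type*} [Field K] [AddCommGroup V] [Module K V]
    {𝒱 : ZMod 2 → Submodule K V} {B : LinearMap.BilinForm K V}
    {e : End K V} {N : ℕ} (D : OspJordanData 𝒱 B e N) : Set (Fin N × ℕ) :=
  {p | p.2 < D.lam p.1 ∧ D.par p.1 = 0 ∧ Odd p.2}

/-- The pairs `(i, k)` with `0 ≤ k ≤ λ_i - 1`, `|i| = 1` and `k` even. -/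
def idx1 {K V : Type*} [Field K] [AddCommGroup V] [Module K V]
    {𝒱 : ZMod 2 → Submodule K V} {B : LinearMap.BilinForm K V}
    {e : End K V} {N : ℕ} (D : OspJordanData 𝒱 B e N) : Set (Fin N × ℕ) :=
  {p | p.2 < D.lam p.1 ∧ D.par p.1 = 1 ∧ Even p.2}

/-- The triples `(i, j, k)` with `0 ≤ k ≤ min(λ_i, λ_j) - 1` and `i* ≠ j`. -/
def idx2 {K V : Type*} [Field K] [AddCommGroup V] [Module K V]
    {𝒱 : ZMod 2 → Submodule K V} {B : LinearMap.BilinForm K V}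
    {e : End K V} {N : ℕ} (D : OspJordanData 𝒱 B e N) : Set (Fin N × Fin N × ℕ) :=
  {t | t.2.2 < min (D.lam t.1) (D.lam t.2.1) ∧ D.star t.1 ≠ t.2.1}

/-- The involution `(i, j, k) ↦ (j*, i*, k)` on triples. -/
def flip {K V : Type*} [Field K] [AddCommGroup V] [Module K V]
    {𝒱 : ZMod 2 → Submodule K V} {B : LinearMap.BilinForm K V}
    {e : End K V} {N : ℕ} (D : OspJordanData 𝒱 B e N) (t : Fin N × Fin N × ℕ) :
    Fin N × Fin N × ℕ :=
  (D.star t.2.1, D.star t.1, t.2.2)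

/-- `T` consists of exactly one of the triples `(i, j, k)`, `(j*, i*, k)` for each
`(i, j, k) ∈ idx2`. -/
def IsTransversal {K V : Type*} [Field K] [AddCommGroup V] [Module K V]
    {𝒱 : ZMod 2 → Submodule K V} {B : LinearMap.BilinForm K V}
    {e : End K V} {N : ℕ} (D : OspJordanData 𝒱 B e N) (T : Set (Fin N × Fin N × ℕ)) : Prop :=
  T ⊆ D.idx2 ∧ ∀ t ∈ D.idx2, Xor (t ∈ T) (D.flip t ∈ T)

/-- The element `ξ_i^{i*, λ_i - 1 - k}` for `p = (i, k)`. -/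
noncomputable def elt01 {K V : Type*} [Field K] [AddCommGroup V] [Module K V]
    {𝒱 : ZMod 2 → Submodule K V} [DirectSum.Decomposition 𝒱] {B : LinearMap.BilinForm K V}
    {e : End K V} {N : ℕ} (D : OspJordanData 𝒱 B e N) (p : Fin N × ℕ) : End K V :=
  D.xi p.1 (D.star p.1) (D.lam p.1 - 1 - p.2)

/-- The element `ξ_i^{j, λ_j - 1 - k} + ε_{i,j,k} ξ_{j*}^{i*, λ_i - 1 - k}` for `t = (i, j, k)`. -/
noncomputable def elt2 {K V : Type*} [Field K] [AddCommGroup V] [Module K V]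
    {𝒱 : ZMod 2 → Submodule K V} [DirectSum.Decomposition 𝒱] {B : LinearMap.BilinForm K V}
    {e : End K V} {N : ℕ} (D : OspJordanData 𝒱 B e N) (t : Fin N × Fin N × ℕ) : End K V :=
  D.xi t.1 t.2.1 (D.lam t.2.1 - 1 - t.2.2)
    + ((D.eps t.1 t.2.1 t.2.2 : ℤ) : K) •
      D.xi (D.star t.2.1) (D.star t.1) (D.lam t.1 - 1 - t.2.2)

/-- The set `S₀`. -/
def S0 {K V : Type*} [Field K] [AddCommGroup V] [Module K V]
    {𝒱 : ZMod 2 → Submodule K V} [DirectSum.Decomposition 𝒱] {B : LinearMap.BilinForm K V}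
    {e : End K V} {N : ℕ} (D : OspJordanData 𝒱 B e N) : Set (End K V) := D.elt01 '' D.idx0

/-- The set `S₁`. -/
def S1 {K V : Type*} [Field K] [AddCommGroup V] [Module K V]
    {𝒱 : ZMod 2 → Submodule K V} [DirectSum.Decomposition 𝒱] {B : LinearMap.BilinForm K V}
    {e : End K V} {N : ℕ} (D : OspJordanData 𝒱 B e N) : Set (End K V) := D.elt01 '' D.idx1

/-- The set `S₂`. -/
def S2 {K V : Type*} [Field K] [AddCommGroup V] [Module K V]
    {𝒱 : ZMod 2 → Submodule K V} [DirectSum.Decomposition 𝒱] {B : LinearMap.BilinForm K V}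
    {e : End K V} {N : ℕ} (D : OspJordanData 𝒱 B e N) : Set (End K V) := D.elt2 '' D.idx2

/-- The elements of `S = S₀ ∪ S₁ ∪ S₂`, with those of `S₂` indexed by the triples in `T` only. -/
noncomputable def family {K V : Type*} [Field K] [AddCommGroup V] [Module K V]
    {𝒱 : ZMod 2 → Submodule K V} [DirectSum.Decomposition 𝒱] {B : LinearMap.BilinForm K V}
    {e : End K V} {N : ℕ} (D : OspJordanData 𝒱 B e N) (T : Set (Fin N × Fin N × ℕ)) :
    (D.idx0 ⊕ D.idx1) ⊕ T → End K V :=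
  Sum.elim (Sum.elim (fun p => D.elt01 p) (fun p => D.elt01 p)) (fun t => D.elt2 t)

end OspJordanData

/-! Existence of the strings. Let `W` be one homogeneous part of `V`; there `B x y = s * B y x` with
`s = (-1)^c`. If `p` is maximal with `e^p ≠ 0` on `W`, the form `B x (e^p y)` is nonzero on `W` and,
since `e` is skew, has symmetry sign `s * (-1)^p`. For sign `+1` it has an anisotropic vector (2 is
invertible), normalised by a square root; for sign `-1` a pair of vectors is used instead. Adding
multiples of higher powers of `e` then kills the unwanted pairings one degree at a time
(`exists_single_string`, `exists_string_pair`). The strings obtained span a nondegenerate `e`-stable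
subspace, so one passes to its orthogonal complement in `W` and inducts on dimension
(`exists_adaptedStrings`). Finally the strings of both parts are merged and sorted so that dual
strings become neighbours (`exists_ospJordanData`).

The basis. An endomorphism commuting with `e` is determined by its values on the `v_i`, and by
nondegeneracy by the scalars `B (x v_i) (e^k v_{j*})`. Up to sign these are the coordinates `coef t`
dual to the `ξ`'s, `t = (i, j, k)` (`coef_xiOf`, `eq_sum_coef_smul`). In these coordinates
invariance of `B` under `x` reads `coef (flip t) x = ε_t * coef t x` (`mem_ospCentralizer_iff`). So
`𝔤^e` is the fixed space of a signed permutation of order at most two, because `ε` is constant on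
`flip`-orbits and `ε_t^2 = 1`. An orbit of size two contributes one line, spanned by `y_t`. A fixed
triple `(i, i*, k)` has `ε = -(-1)^(|i| + k)`: it contributes `ξ` itself when `ε = 1`, which is
exactly the index condition of `S₀` or `S₁`, and nothing when `ε = -1`, as 2 is invertible. -/

/-! ### Skew endomorphisms and strings adapted to the form -/

section Skew

variable {K V : Type*} [Field K] [AddCommGroup V] [Module K V]

theorem form_pow_left {B : LinearMap.BilinForm K V} {e : End K V}
    (he : ∀ u w, B (e u) w = -B u (e w)) (a : ℕ) (u w : V) :
    B ((e ^ a) u) w = (-1) ^ a * B u ((e ^ a) w) := by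
  induction a generalizing u with
  | zero => simp
  | succ a ih =>
    rw [pow_succ, Module.End.mul_apply, ih, he, ← Module.End.mul_apply, ← pow_succ', pow_succ]
    ring

theorem form_pow_pow {B : LinearMap.BilinForm K V} {e : End K V}
    (he : ∀ u w, B (e u) w = -B u (e w)) (a b : ℕ) (u w : V) :
    B ((e ^ a) u) ((e ^ b) w) = (-1) ^ a * B u ((e ^ (a + b)) w) := by
  rw [form_pow_left he, pow_add, Module.End.mul_apply]

theorem pow_apply_mem {e : End K V} {W : Submodule K V} (he : ∀ x ∈ W, e x ∈ W) (k : ℕ)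
    {x : V} (hx : x ∈ W) : (e ^ k) x ∈ W := by
  induction k with
  | zero => simpa
  | succ k ih => rw [pow_succ', Module.End.mul_apply]; exact he _ ih

theorem pow_apply_eq_zero_of_le {e : End K V} {x : V} {a b : ℕ} (h : (e ^ a) x = 0)
    (hab : a ≤ b) : (e ^ b) x = 0 := by
  rw [← Nat.sub_add_cancel hab, pow_add, Module.End.mul_apply, h, map_zero]

/-- Jordan strings adapted to the form `B`, indexed by an arbitrary type. -/
structure AdaptedStrings (B : LinearMap.BilinForm K V) (e : End K V) (ι : Type) where
  lam : ι → ℕ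
  par : ι → ZMod 2
  v : ι → V
  star : ι → ι
  theta : ι → ℤˣ
  lam_pos : ∀ i, 0 < lam i
  pow_lam : ∀ i, (e ^ lam i) (v i) = 0
  star_star : ∀ i, star (star i) = i
  lam_star : ∀ i, lam (star i) = lam i
  par_star : ∀ i, par (star i) = par i
  star_eq_of_even : ∀ i, par i = 0 → Odd (lam i) → star i = i
  star_eq_of_odd : ∀ i, par i = 1 → Even (lam i) → star i = i
  form_star : ∀ i b, b + 1 = lam i → B (v i) ((e ^ b) (v (star i))) = ((theta i : ℤ) : K)
  form_zero : ∀ i j b, (j ≠ star i ∨ b + 1 ≠ lam i) → B (v i) ((e ^ b) (v j)) = 0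

namespace AdaptedStrings

variable {B : LinearMap.BilinForm K V} {e : End K V} {ι κ : Type}

/-- The span of the strings of parity `c`. -/
def part (S : AdaptedStrings B e ι) (c : ZMod 2) : Submodule K V :=
  Submodule.span K {x : V | ∃ i, S.par i = c ∧ ∃ k < S.lam i, x = (e ^ k) (S.v i)}

theorem pow_mem_part (S : AdaptedStrings B e ι) (i : ι) (k : ℕ) :
    (e ^ k) (S.v i) ∈ S.part (S.par i) := by
  rcases lt_or_ge k (S.lam i) with h | h
  · exact Submodule.subset_span ⟨i, rfl, k, h, rfl⟩
  · rw [pow_apply_eq_zero_of_le (S.pow_lam i) h]; exact zero_mem _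

theorem part_le (S : AdaptedStrings B e ι) (c : ZMod 2) {W : Submodule K V}
    (h : ∀ i, S.par i = c → ∀ k, (e ^ k) (S.v i) ∈ W) : S.part c ≤ W := by
  refine Submodule.span_le.2 ?_
  rintro _ ⟨i, hi, k, _, rfl⟩
  exact h i hi k

/-- The union of two mutually orthogonal systems of adapted strings. -/
def sum (S : AdaptedStrings B e ι) (T : AdaptedStrings B e κ)
    (h₁ : ∀ i j b, B (S.v i) ((e ^ b) (T.v j)) = 0)
    (h₂ : ∀ i j b, B (T.v j) ((e ^ b) (S.v i)) = 0) : AdaptedStrings B e (ι ⊕ κ) where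
  lam := Sum.elim S.lam T.lam
  par := Sum.elim S.par T.par
  v := Sum.elim S.v T.v
  star := Sum.map S.star T.star
  theta := Sum.elim S.theta T.theta
  lam_pos := by rintro (i | i) <;> simp [S.lam_pos, T.lam_pos]
  pow_lam := by rintro (i | i) <;> simp [S.pow_lam, T.pow_lam]
  star_star := by rintro (i | i) <;> simp [S.star_star, T.star_star]
  lam_star := by rintro (i | i) <;> simp [S.lam_star, T.lam_star]
  par_star := by rintro (i | i) <;> simp [S.par_star, T.par_star]
  star_eq_of_even := by
    rintro (i | i) h h'
    · simpa using S.star_eq_of_even i h h'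
    · simpa using T.star_eq_of_even i h h'
  star_eq_of_odd := by
    rintro (i | i) h h'
    · simpa using S.star_eq_of_odd i h h'
    · simpa using T.star_eq_of_odd i h h'
  form_star := by
    rintro (i | i) b h
    · simpa using S.form_star i b h
    · simpa using T.form_star i b h
  form_zero := by
    rintro (i | i) (j | j) b h
    · exact S.form_zero i j b (by simpa using h)
    · exact h₁ i j b
    · exact h₂ j i b
    · exact T.form_zero i j b (by simpa using h)

theorem sum_part (S : AdaptedStrings B e ι) (T : AdaptedStrings B e κ)
    (h₁ : ∀ i j b, B (S.v i) ((e ^ b) (T.v j)) = 0)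
    (h₂ : ∀ i j b, B (T.v j) ((e ^ b) (S.v i)) = 0) (c : ZMod 2) :
    (S.sum T h₁ h₂).part c = S.part c ⊔ T.part c := by
  apply le_antisymm
  · refine part_le _ c ?_
    rintro (i | i) rfl k
    · exact Submodule.mem_sup_left (S.pow_mem_part i k)
    · exact Submodule.mem_sup_right (T.pow_mem_part i k)
  · refine sup_le (part_le _ c ?_) (part_le _ c ?_)
    · rintro i rfl k
      exact (S.sum T h₁ h₂).pow_mem_part (Sum.inl i) k
    · rintro i rfl k
      exact (S.sum T h₁ h₂).pow_mem_part (Sum.inr i) k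

/-- Skewness of `e` moves all powers to the right-hand argument, so pairings with `a = 0` determine
the rest. -/
theorem form_eq_of_ne (S : AdaptedStrings B e ι) (he : ∀ u w, B (e u) w = -B u (e w))
    {i j : ι} {a b : ℕ} (h : j ≠ S.star i ∨ a + b + 1 ≠ S.lam i) :
    B ((e ^ a) (S.v i)) ((e ^ b) (S.v j)) = 0 := by
  rw [form_pow_pow he, S.form_zero i j _ h, mul_zero]

theorem form_eq_star (S : AdaptedStrings B e ι) (he : ∀ u w, B (e u) w = -B u (e w))
    {i : ι} {a b : ℕ} (h : a + b + 1 = S.lam i) :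
    B ((e ^ a) (S.v i)) ((e ^ b) (S.v (S.star i))) = (-1) ^ a * ((S.theta i : ℤ) : K) := by
  rw [form_pow_pow he, S.form_star i _ h]

theorem theta_mul_theta (S : AdaptedStrings B e ι) (i : ι) :
    ((S.theta i : ℤ) : K) * ((S.theta i : ℤ) : K) = 1 := by
  rcases Int.units_eq_one_or (S.theta i) with h | h <;> simp [h]

/-- Orthogonal projection onto the span of the strings: up to sign, `e^l v_j` is dual to `e^(λ_j - 1
- l) v_{j*}`, and pairing `w` with the latter gives the coefficient `f j l`. -/
theorem exists_projection [Fintype ι] (S : AdaptedStrings B e ι)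
    (he : ∀ u w, B (e u) w = -B u (e w)) {c : ZMod 2} (hc : ∀ i, S.par i = c) (w : V) :
    ∃ u ∈ S.part c, ∀ i k, B ((e ^ k) (S.v i)) (w - u) = 0 := by
  classical
  let f : ι → ℕ → K := fun j l =>
    (-1) ^ (S.lam j - 1 - l) * ((S.theta (S.star j) : ℤ) : K) *
      B ((e ^ (S.lam j - 1 - l)) (S.v (S.star j))) w
  refine ⟨∑ j, ∑ l ∈ Finset.range (S.lam j), f j l • (e ^ l) (S.v j), ?_, fun i k => ?_⟩
  · refine Submodule.sum_mem _ fun j _ => Submodule.sum_mem _ fun l _ => Submodule.smul_mem _ _ ?_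
    rw [← hc j]; exact S.pow_mem_part j l
  · rcases lt_or_ge k (S.lam i) with hk | hk
    · have hs := S.lam_star i
      rw [map_sub, sub_eq_zero, map_sum, Finset.sum_eq_single (S.star i), map_sum,
        Finset.sum_eq_single (S.lam i - 1 - k), map_smul, S.form_eq_star he (by omega)]
      · simp only [f, smul_eq_mul, S.star_star, hs]
        rw [show S.lam i - 1 - (S.lam i - 1 - k) = k by omega]
        have h1 : ((-1 : K) ^ k) * (-1) ^ k = 1 := by rw [← mul_pow]; simp
        linear_combination (-B ((e ^ k) (S.v i)) w * (S.theta i : ℤ) * (S.theta i : ℤ)) * h1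
          - B ((e ^ k) (S.v i)) w * S.theta_mul_theta i
      · intro l hl hl'
        rw [map_smul, S.form_eq_of_ne he (Or.inr (by omega)), smul_zero]
      · intro h; exact absurd (Finset.mem_range.2 (by omega)) h
      · intro j _ hj
        rw [map_sum]
        refine Finset.sum_eq_zero fun l _ => ?_
        rw [map_smul, S.form_eq_of_ne he (Or.inl hj), smul_zero]
      · simp
    · rw [pow_apply_eq_zero_of_le (S.pow_lam i) hk, map_zero, LinearMap.zero_apply]

end AdaptedStrings

/-! ### Normalising a string, or a pair of strings, of maximal length -/

section Block

variable {B : LinearMap.BilinForm K V} {e : End K V} {W : Submodule K V} {s : K} {p : ℕ}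

/-- Polarisation: a symmetric form with all `f v v = 0` satisfies `2 * f x y = 0`. -/
theorem exists_form_self_ne_zero {f : V → V → K} (h2 : (2 : K) ≠ 0)
    (hadd : ∀ x y, f (x + y) (x + y) = f x x + f x y + f y x + f y y)
    (hsymm : ∀ x ∈ W, ∀ y ∈ W, f x y = f y x) {x y : V} (hx : x ∈ W) (hy : y ∈ W)
    (hxy : f x y ≠ 0) : ∃ v ∈ W, f v v ≠ 0 := by
  by_contra! h
  have h1 := hadd x y
  rw [h _ (W.add_mem hx hy), h x hx, h y hy, ← hsymm x hx y hy] at h1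
  exact mul_ne_zero h2 hxy (by linear_combination -h1)

theorem form_pow_symm (he : ∀ u w, B (e u) w = -B u (e w)) (hW : ∀ x ∈ W, e x ∈ W)
    (hs : ∀ x ∈ W, ∀ y ∈ W, B x y = s * B y x) (b : ℕ) {x y : V} (hx : x ∈ W) (hy : y ∈ W) :
    B x ((e ^ b) y) = s * (-1) ^ b * B y ((e ^ b) x) := by
  rw [hs x hx _ (pow_apply_mem hW b hy), form_pow_left he, mul_assoc]

/-- Descending correction: stage `j` clears the degrees `b` with `p - j ≤ b < p`, and a correction
by `e^(j + 1) v` affects only degrees at most `p - (j + 1)`. At `j = p` every degree below `p` is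
clear. -/
theorem exists_single_string (h2 : (2 : K) ≠ 0) (he : ∀ u w, B (e u) w = -B u (e w))
    (hW : ∀ x ∈ W, e x ∈ W) (hs : ∀ x ∈ W, ∀ y ∈ W, B x y = s * B y x)
    (hp : ∀ x ∈ W, (e ^ (p + 1)) x = 0) (hsp : s * (-1) ^ p = 1)
    {x : V} (hx : x ∈ W) (hxp : B x ((e ^ p) x) = 1) (j : ℕ) (hj : j ≤ p) :
    ∃ v ∈ W, B v ((e ^ p) v) = 1 ∧ ∀ b < p, p ≤ b + j → B v ((e ^ b) v) = 0 := by
  induction j with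
  | zero => exact ⟨x, hx, hxp, fun b hb hb' => by omega⟩
  | succ j ih =>
    obtain ⟨v, hv, hvp, hvb⟩ := ih (by omega)
    have hz : ∀ n, p < n → (e ^ n) v = 0 := fun n hn => pow_apply_eq_zero_of_le (hp v hv) hn
    obtain ⟨b₀, hb₀⟩ : ∃ b₀, b₀ + (j + 1) = p := ⟨p - (j + 1), by omega⟩
    rcases Nat.even_or_odd (j + 1) with hm | hm
    -- With `j + 1` even the two cross terms agree, so the pairing in degree `b₀` changes by `2 * d
    -- * B v (e^p v) = 2 * d`.
    · let d : K := -B v ((e ^ b₀) v) / 2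
      have key : ∀ b, B (v + d • (e ^ (j + 1)) v) ((e ^ b) (v + d • (e ^ (j + 1)) v)) =
          B v ((e ^ b) v) + 2 * d * B v ((e ^ (b + (j + 1))) v)
            + d * d * B v ((e ^ (j + 1 + (b + (j + 1)))) v) := by
        intro b
        simp only [map_add, map_smul, LinearMap.add_apply, LinearMap.smul_apply, smul_eq_mul,
          form_pow_pow he, hm.neg_one_pow, ← Module.End.mul_apply, ← pow_add, one_mul]
        rw [add_comm (j + 1) b]
        ring
      refine ⟨v + d • (e ^ (j + 1)) v, W.add_mem hv (W.smul_mem _ (pow_apply_mem hW _ hv)),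
        ?_, fun b hb hb' => ?_⟩
      · rw [key, hz (p + (j + 1)) (by omega), hz (j + 1 + (p + (j + 1))) (by omega), hvp]
        simp
      · rw [key, hz (j + 1 + (b + (j + 1))) (by omega)]
        rcases eq_or_ne b b₀ with rfl | hne
        · rw [hb₀, hvp]
          simp only [map_zero, d]
          field_simp
          ring
        · rw [hz (b + (j + 1)) (by omega), hvb b hb (by omega)]
          simp
    -- With `j + 1` odd no correction is needed: the form `B x (e^b₀ y)` is skew, hence zero on the
    -- diagonal.
    · refine ⟨v, hv, hvp, fun b hb hb' => ?_⟩
      rcases eq_or_ne b b₀ with rfl | hne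
      · have h1 := form_pow_symm he hW hs b hv hv
        have h3 : s * (-1) ^ b = -1 := by
          rw [← hb₀, pow_add, hm.neg_one_pow] at hsp
          linear_combination -hsp
        rw [h3] at h1
        exact (mul_eq_zero.1 (by linear_combination h1 : 2 * B v ((e ^ b) v) = 0)).resolve_left h2
      · exact hvb b hb (by omega)

/-- The same descent for two vectors. In degree `b₀`, `f` removes the pairing of `u` with `v`, while
`a` and `d` remove the self-pairings of `u` and `v`. The self-pairings vanish automatically when `j
+ 1` is even; when it is odd they change by `2 * a` and `-2 * d`. -/
theorem exists_string_pair (h2 : (2 : K) ≠ 0) (he : ∀ u w, B (e u) w = -B u (e w))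
    (hW : ∀ x ∈ W, e x ∈ W) (hs : ∀ x ∈ W, ∀ y ∈ W, B x y = s * B y x)
    (hp : ∀ x ∈ W, (e ^ (p + 1)) x = 0) (hsp : s * (-1) ^ p = -1)
    {x y : V} (hx : x ∈ W) (hy : y ∈ W) (hxy : B x ((e ^ p) y) = 1) (j : ℕ) (hj : j ≤ p) :
    ∃ u ∈ W, ∃ v ∈ W, B u ((e ^ p) v) = 1 ∧ ∀ b < p, p ≤ b + j →
      B u ((e ^ b) v) = 0 ∧ B u ((e ^ b) u) = 0 ∧ B v ((e ^ b) v) = 0 := by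
  induction j with
  | zero => exact ⟨x, hx, y, hy, hxy, fun b hb hb' => by omega⟩
  | succ j ih =>
    obtain ⟨u, hu, v, hv, huv, hb⟩ := ih (by omega)
    have hz : ∀ w ∈ W, ∀ n, p < n → (e ^ n) w = 0 :=
      fun w hw n hn => pow_apply_eq_zero_of_le (hp w hw) hn
    have hself : ∀ w ∈ W, ∀ b, s * (-1) ^ b = -1 → B w ((e ^ b) w) = 0 := by
      intro w hw b h3
      have h1 := form_pow_symm he hW hs b hw hw
      rw [h3] at h1
      exact (mul_eq_zero.1 (by linear_combination h1 : 2 * B w ((e ^ b) w) = 0)).resolve_left h2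
    have hvu : B v ((e ^ p) u) = -1 := by
      rw [form_pow_symm he hW hs p hv hu, hsp, huv, mul_one]
    obtain ⟨b₀, hb₀⟩ : ∃ b₀, b₀ + (j + 1) = p := ⟨p - (j + 1), by omega⟩
    have hss : ((-1 : K) ^ (j + 1)) * (-1) ^ (j + 1) = 1 := by rw [← mul_pow]; simp
    let a : K := -B u ((e ^ b₀) u) / 2
    let d : K := B v ((e ^ b₀) v) / 2
    let f : K := -(-1) ^ (j + 1) * B u ((e ^ b₀) v)
    have hu' : u + (a • (e ^ (j + 1)) v + f • (e ^ (j + 1)) u) ∈ W :=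
      W.add_mem hu (W.add_mem (W.smul_mem _ (pow_apply_mem hW _ hv))
        (W.smul_mem _ (pow_apply_mem hW _ hu)))
    have hv' : v + d • (e ^ (j + 1)) u ∈ W :=
      W.add_mem hv (W.smul_mem _ (pow_apply_mem hW _ hu))
    refine ⟨_, hu', _, hv', ?_, fun b hbp hb' => ?_⟩
    · simp only [map_add, map_smul, LinearMap.add_apply, LinearMap.smul_apply, smul_eq_mul,
        form_pow_pow he, ← Module.End.mul_apply, ← pow_add]
      simp only [hz u hu (p + (j + 1)) (by omega), hz v hv (j + 1 + p) (by omega),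
        hz u hu (j + 1 + (p + (j + 1))) (by omega), map_zero, huv]
      ring
    · rcases eq_or_ne b b₀ with rfl | hne
      · have hj1 : j + 1 + b = p := by omega
        refine ⟨?_, ?_, ?_⟩
        · simp only [map_add, map_smul, LinearMap.add_apply, LinearMap.smul_apply, smul_eq_mul,
            form_pow_pow he, ← Module.End.mul_apply, ← pow_add]
          simp only [hb₀, hj1, hz u hu (j + 1 + p) (by omega), huv, map_zero,
            hself u hu p hsp, hself v hv p hsp, f]
          linear_combination -B u ((e ^ b) v) * hss
        · rcases Nat.even_or_odd (j + 1) with hm | hm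
          · refine hself _ hu' b ?_
            rw [← hb₀, pow_add, hm.neg_one_pow] at hsp
            linear_combination hsp
          · simp only [map_add, map_smul, LinearMap.add_apply, LinearMap.smul_apply, smul_eq_mul,
              form_pow_pow he, ← Module.End.mul_apply, ← pow_add, hm.neg_one_pow]
            simp only [hb₀, hj1, hz u hu (j + 1 + p) (by omega), hz v hv (j + 1 + p) (by omega),
              huv, hvu, map_zero, hself u hu p hsp, a]
            field_simp
            ring
        · rcases Nat.even_or_odd (j + 1) with hm | hm
          · refine hself _ hv' b ?_
            rw [← hb₀, pow_add, hm.neg_one_pow] at hsp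
            linear_combination hsp
          · simp only [map_add, map_smul, LinearMap.add_apply, LinearMap.smul_apply, smul_eq_mul,
              form_pow_pow he, ← Module.End.mul_apply, ← pow_add, hm.neg_one_pow]
            simp only [hb₀, hj1, hz u hu (j + 1 + p) (by omega),
              huv, hvu, map_zero, d]
            field_simp
            ring
      · obtain ⟨h3, h4, h5⟩ := hb b hbp (by omega)
        refine ⟨?_, ?_, ?_⟩
        all_goals
          simp only [map_add, map_smul, LinearMap.add_apply, LinearMap.smul_apply, smul_eq_mul,
            form_pow_pow he, ← Module.End.mul_apply, ← pow_add]
          simp only [hz u hu (b + (j + 1)) (by omega), hz v hv (b + (j + 1)) (by omega),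
            hz u hu (j + 1 + b) (by omega), hz v hv (j + 1 + b) (by omega),
            hz u hu (j + 1 + (b + (j + 1))) (by omega),
            hz v hv (j + 1 + (b + (j + 1))) (by omega), map_zero, h3, h4, h5]
          ring

end Block

end Skew

/-! ### Decomposition of a homogeneous part into adapted strings -/

section Existence

variable {K V : Type*} [Field K] [AddCommGroup V] [Module K V]
  {B : LinearMap.BilinForm K V} {e : End K V} {W : Submodule K V}

/-- A single adapted string. -/
def AdaptedStrings.single (c : ZMod 2) (p : ℕ) (x : V) (hp : (e ^ (p + 1)) x = 0)
    (hx : B x ((e ^ p) x) = 1) (hb : ∀ b < p, B x ((e ^ b) x) = 0) :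
    AdaptedStrings B e Unit where
  lam _ := p + 1
  par _ := c
  v _ := x
  star := id
  theta _ := 1
  lam_pos _ := p.succ_pos
  pow_lam _ := hp
  star_star _ := rfl
  lam_star _ := rfl
  par_star _ := rfl
  star_eq_of_even _ _ _ := rfl
  star_eq_of_odd _ _ _ := rfl
  form_star _ b h := by obtain rfl : b = p := by omega
                        simpa using hx
  form_zero _ _ b h := by
    rcases lt_trichotomy b p with h' | h' | h'
    · exact hb b h'
    · simp [h'] at h
    · rw [pow_apply_eq_zero_of_le hp h', map_zero]

/-- A dual pair of adapted strings. -/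
def AdaptedStrings.pair (c : ZMod 2) (p : ℕ) (x y : V)
    (h₀ : c = 0 → ¬ Odd (p + 1)) (h₁ : c = 1 → ¬ Even (p + 1))
    (hpx : (e ^ (p + 1)) x = 0) (hpy : (e ^ (p + 1)) y = 0)
    (hxy : B x ((e ^ p) y) = 1) (hyx : B y ((e ^ p) x) = -1)
    (hbx : ∀ b ≤ p, B x ((e ^ b) x) = 0) (hby : ∀ b ≤ p, B y ((e ^ b) y) = 0)
    (hbxy : ∀ b < p, B x ((e ^ b) y) = 0) (hbyx : ∀ b < p, B y ((e ^ b) x) = 0) :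
    AdaptedStrings B e Bool where
  lam _ := p + 1
  par _ := c
  v i := cond i y x
  star := not
  theta i := cond i (-1) 1
  lam_pos _ := p.succ_pos
  pow_lam i := by cases i <;> assumption
  star_star i := by simp
  lam_star _ := rfl
  par_star _ := rfl
  star_eq_of_even _ h h' := absurd h' (h₀ h)
  star_eq_of_odd _ h h' := absurd h' (h₁ h)
  form_star i b h := by
    obtain rfl : b = p := by omega
    cases i
    · simpa using hxy
    · simpa using hyx
  form_zero i j b h := by
    rcases lt_or_ge p b with h' | h'
    · have : (e ^ b) (cond j y x) = 0 := by
        cases j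
        · exact pow_apply_eq_zero_of_le hpx h'
        · exact pow_apply_eq_zero_of_le hpy h'
      rw [this, map_zero]
    · cases i <;> cases j
      · exact hbx b h'
      · exact hbxy b (lt_of_le_of_ne h' (by rintro rfl; simp at h))
      · exact hbyx b (lt_of_le_of_ne h' (by rintro rfl; simp at h))
      · exact hby b h'

theorem exists_adaptedStrings_block [IsAlgClosed K] (h2 : (2 : K) ≠ 0)
    (he : ∀ u w, B (e u) w = -B u (e w)) (hnil : IsNilpotent e) (c : ZMod 2)
    (hW : ∀ x ∈ W, e x ∈ W) (hs : ∀ x ∈ W, ∀ y ∈ W, B x y = (-1) ^ c.val * B y x)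
    (hnd : ∀ x ∈ W, (∀ y ∈ W, B y x = 0) → x = 0) (hbot : W ≠ ⊥) :
    ∃ (ι : Type) (_ : Fintype ι) (_ : Nonempty ι) (S : AdaptedStrings B e ι),
      (∀ i, S.par i = c) ∧ ∀ i, S.v i ∈ W := by
  classical
  -- `p + 1` is the nilpotency index of `e` on `W`; it is positive because `W` is nonzero.
  obtain ⟨p, hp, hp'⟩ : ∃ p, (∀ x ∈ W, (e ^ (p + 1)) x = 0) ∧ ∃ x ∈ W, (e ^ p) x ≠ 0 := by
    have hex : ∃ n, ∀ x ∈ W, (e ^ n) x = 0 := by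
      obtain ⟨n, hn⟩ := hnil
      exact ⟨n, fun x _ => by rw [hn, LinearMap.zero_apply]⟩
    have h0 : Nat.find hex ≠ 0 := by
      intro h
      have := Nat.find_spec hex
      rw [h] at this
      exact hbot ((Submodule.eq_bot_iff W).2 (by simpa using this))
    obtain ⟨p, hp⟩ := Nat.exists_eq_succ_of_ne_zero h0
    refine ⟨p, ?_, ?_⟩
    · have := Nat.find_spec hex
      rwa [hp] at this
    · have := Nat.find_min hex (m := p) (by omega)
      push Not at this
      exact this
  obtain ⟨y, hy, hyp⟩ := hp'
  obtain ⟨x, hx, hxy⟩ : ∃ x ∈ W, B x ((e ^ p) y) ≠ 0 := by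
    by_contra! h
    exact hyp (hnd _ (pow_apply_mem hW p hy) h)
  have hsign : ((-1 : K) ^ c.val * (-1) ^ p = 1) ∨ ((-1 : K) ^ c.val * (-1) ^ p = -1) := by
    rw [← pow_add]; exact neg_one_pow_eq_or K _
  rcases hsign with hsp | hsp
  · obtain ⟨v, hv, hvv⟩ := exists_form_self_ne_zero (W := W) (f := fun x y => B x ((e ^ p) y)) h2
      (fun x y => by simp only [map_add, LinearMap.add_apply]; ring)
      (fun x hx y hy => by rw [form_pow_symm he hW hs p hx hy, hsp, one_mul]) hx hy hxy
    -- Dividing `v` by a square root of `B v (e^p v)` normalises that value to 1.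
    obtain ⟨z, hz⟩ := IsAlgClosed.exists_eq_mul_self (B v ((e ^ p) v))
    have hz0 : z ≠ 0 := by rintro rfl; exact hvv (by simpa using hz)
    obtain ⟨w, hw, hw1, hwb⟩ := exists_single_string h2 he hW hs hp hsp
      (W.smul_mem z⁻¹ hv) (by
        simp only [map_smul, LinearMap.smul_apply, smul_eq_mul]
        rw [hz]; field_simp) p le_rfl
    exact ⟨Unit, inferInstance, inferInstance,
      .single c p w (hp w hw) hw1 (fun b hb => hwb b hb (by omega)), fun _ => rfl, fun _ => hw⟩
  · obtain ⟨u, hu, v, hv, huv, hb⟩ := exists_string_pair h2 he hW hs hp hsp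
      (W.smul_mem (B x ((e ^ p) y))⁻¹ hx) hy (by
        simp only [map_smul, LinearMap.smul_apply, smul_eq_mul]
        field_simp) p le_rfl
    have hself : ∀ w ∈ W, B w ((e ^ p) w) = 0 := by
      intro w hw
      have h1 := form_pow_symm he hW hs p hw hw
      rw [hsp] at h1
      exact (mul_eq_zero.1 (by linear_combination h1 : 2 * B w ((e ^ p) w) = 0)).resolve_left h2
    have hne : (1 : K) ≠ -1 := fun h => h2 (by linear_combination h)
    refine ⟨Bool, inferInstance, inferInstance,
      .pair c p u v ?_ ?_ (hp u hu) (hp v hv) huv ?_ ?_ ?_ ?_ ?_, fun _ => rfl, ?_⟩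
    -- Sign `-1` forces `p + 1` to be even for even parity and odd for odd parity, which is where a
    -- string may differ from its dual.
    · rintro rfl h
      have h' : Even p := by simpa [Nat.odd_add_one] using h
      rw [h'.neg_one_pow] at hsp
      exact hne (by simpa using hsp)
    · rintro rfl h
      have h' : Odd p := by simpa [Nat.even_add_one] using h
      rw [h'.neg_one_pow] at hsp
      exact hne (by simpa [ZMod.val_one] using hsp)
    · rw [form_pow_symm he hW hs p hv hu, hsp, huv, mul_one]
    · intro b hbp
      rcases hbp.lt_or_eq with h | rfl
      · exact (hb b h (by omega)).2.1
      · exact hself u hu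
    · intro b hbp
      rcases hbp.lt_or_eq with h | rfl
      · exact (hb b h (by omega)).2.2
      · exact hself v hv
    · exact fun b h => (hb b h (by omega)).1
    · intro b h
      rw [form_pow_symm he hW hs b hv hu, (hb b h (by omega)).1, mul_zero]
    · rintro (_ | _)
      · exact hu
      · exact hv

/-- Induction on the dimension of `W`: split off a block and continue in its orthogonal complement
`W'`. -/
theorem exists_adaptedStrings [IsAlgClosed K] [FiniteDimensional K V] (h2 : (2 : K) ≠ 0)
    (he : ∀ u w, B (e u) w = -B u (e w)) (hnil : IsNilpotent e) (c : ZMod 2)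
    (W : Submodule K V)
    (hW : ∀ x ∈ W, e x ∈ W) (hs : ∀ x ∈ W, ∀ y ∈ W, B x y = (-1) ^ c.val * B y x)
    (hnd : ∀ x ∈ W, (∀ y ∈ W, B y x = 0) → x = 0) :
    ∃ (ι : Type) (_ : Fintype ι) (S : AdaptedStrings B e ι),
      (∀ i, S.par i = c) ∧ S.part c = W := by
  induction hn : finrank K W using Nat.strong_induction_on generalizing W with
  | _ n ih =>
  subst hn
  by_cases hbot : W = ⊥
  · refine ⟨Empty, inferInstance, ⟨nofun, nofun, nofun, nofun, nofun, nofun, nofun, nofun, nofun,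
      nofun, nofun, nofun, nofun, nofun⟩, nofun, ?_⟩
    rw [hbot, eq_bot_iff]
    exact AdaptedStrings.part_le _ _ nofun
  obtain ⟨ι, _, ⟨i₀⟩, S, hc, hS⟩ := exists_adaptedStrings_block h2 he hnil c hW hs hnd hbot
  have hSW : ∀ i k, (e ^ k) (S.v i) ∈ W := fun i k => pow_apply_mem hW k (hS i)
  have hpart : S.part c ≤ W := S.part_le c fun i _ k => hSW i k
  let W' : Submodule K V := W ⊓ ⨅ i, ⨅ k : ℕ, LinearMap.ker (B ((e ^ k) (S.v i)))
  have hmem : ∀ x, x ∈ W' ↔ x ∈ W ∧ ∀ i (k : ℕ), B ((e ^ k) (S.v i)) x = 0 := by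
    intro x; simp [W', Submodule.mem_iInf]
  have hlt : finrank K W' < finrank K W := by
    refine Submodule.finrank_lt_finrank_of_lt (lt_of_le_of_ne inf_le_left fun h => ?_)
    -- The end of the string dual to `i₀` pairs with `v_{i₀}` to a sign, so it lies in `W` but not
    -- in `W'`.
    have h1 := ((hmem _).1 (h ▸ hSW (S.star i₀) (S.lam i₀ - 1))).2 i₀ 0
    rw [pow_zero, Module.End.one_apply,
      S.form_star i₀ _ (Nat.sub_add_cancel (S.lam_pos i₀))] at h1
    have := S.theta_mul_theta (K := K) i₀
    rw [h1, mul_zero] at this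
    exact zero_ne_one this
  have hproj : ∀ w ∈ W, ∃ u ∈ S.part c, w - u ∈ W' := by
    intro w hw
    obtain ⟨u, hu, h⟩ := S.exists_projection he hc w
    exact ⟨u, hu, (hmem _).2 ⟨W.sub_mem hw (hpart hu), h⟩⟩
  have horth : ∀ u ∈ S.part c, ∀ x ∈ W', B u x = 0 := by
    intro u hu x hx
    have : S.part c ≤ LinearMap.ker (B.flip x) :=
      S.part_le c fun i _ k => ((hmem x).1 hx).2 i k
    exact this hu
  obtain ⟨κ, _, T, hcT, hT⟩ := ih _ hlt W'
    (fun x hx => (hmem _).2 ⟨hW x ((hmem x).1 hx).1, fun i k => by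
      have h := ((hmem x).1 hx).2 i (k + 1)
      rw [pow_succ', Module.End.mul_apply, he] at h
      exact neg_eq_zero.1 h⟩)
    (fun x hx y hy => hs x ((hmem x).1 hx).1 y ((hmem y).1 hy).1)
    -- `W` is the sum of the block and `W'`, so a vector of `W'` orthogonal to `W'` is orthogonal to
    -- `W`.
    (fun x hx h => hnd x ((hmem x).1 hx).1 fun y hy => by
      obtain ⟨u, hu, hyu⟩ := hproj y hy
      rw [← sub_add_cancel y u, map_add, LinearMap.add_apply, h _ hyu, horth u hu x hx, add_zero])
    rfl
  have hTm : ∀ j b, (e ^ b) (T.v j) ∈ W' := fun j b => by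
    rw [← hT, ← hcT j]; exact T.pow_mem_part j b
  have h₁ : ∀ i j (b : ℕ), B (S.v i) ((e ^ b) (T.v j)) = 0 := fun i j b =>
    ((hmem _).1 (hTm j b)).2 i 0
  have h₂ : ∀ i j (b : ℕ), B (T.v j) ((e ^ b) (S.v i)) = 0 := fun i j b => by
    have h := hTm j 0
    rw [pow_zero, Module.End.one_apply] at h
    rw [hs _ ((hmem _).1 h).1 _ (hSW i b), ((hmem _).1 h).2 i b, mul_zero]
  refine ⟨ι ⊕ κ, inferInstance, S.sum T h₁ h₂, ?_, ?_⟩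
  · rintro (i | i)
    · exact hc i
    · exact hcT i
  · rw [S.sum_part T h₁ h₂, hT]
    refine le_antisymm (sup_le hpart inf_le_left) fun w hw => ?_
    obtain ⟨u, hu, h⟩ := hproj w hw
    exact Submodule.mem_sup.2 ⟨u, hu, w - u, h, by abel⟩

/-! ### Sorting the strings and linear independence -/

namespace AdaptedStrings

variable {ι : Type}

/-- A sorting key for the strings: longer strings first, even strings before odd strings of the
same length, and dual strings next to each other. -/
def key (S : AdaptedStrings B e ι) (g : ι → ℕ) (i : ι) : ℕᵒᵈ ×ₗ ℕ ×ₗ ℕ ×ₗ ℕ :=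
  toLex (OrderDual.toDual (S.lam i),
    toLex ((S.par i).val, toLex (min (g i) (g (S.star i)), g i)))

theorem key_injective (S : AdaptedStrings B e ι) {g : ι → ℕ} (hg : Function.Injective g) :
    Function.Injective (S.key g) := by
  intro i j h
  simp only [key, EmbeddingLike.apply_eq_iff_eq, Prod.mk.injEq] at h
  exact hg h.2.2.2

theorem lam_le_of_key_le (S : AdaptedStrings B e ι) {g : ι → ℕ} {i j : ι}
    (h : S.key g i ≤ S.key g j) : S.lam j ≤ S.lam i := by
  rw [key, key, Prod.Lex.toLex_le_toLex] at h
  rcases h with h | h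
  · exact (OrderDual.toDual_lt_toDual.1 h).le
  · exact (OrderDual.toDual.injective h.1).ge

theorem key_lt_of_par (S : AdaptedStrings B e ι) {g : ι → ℕ} {i j : ι}
    (h : S.lam i = S.lam j) (hi : S.par i = 0) (hj : S.par j = 1) :
    S.key g i < S.key g j := by
  rw [key, key, Prod.Lex.toLex_lt_toLex]
  refine Or.inr ⟨by simp [h], ?_⟩
  rw [Prod.Lex.toLex_lt_toLex]
  left
  simp [hi, hj, ZMod.val_one]

/-- Both ends share length, parity and orbit minimum, so anything between them does too; equal
minima with `g` injective mean equal `star`-orbits. This is what makes dual strings adjacent after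
sorting. -/
theorem eq_or_eq_star_of_key_between (S : AdaptedStrings B e ι) {g : ι → ℕ}
    (hg : Function.Injective g) {i j : ι} (h₁ : S.key g i ≤ S.key g j)
    (h₂ : S.key g j ≤ S.key g (S.star i)) : j = i ∨ j = S.star i := by
  simp only [key, Prod.Lex.toLex_le_toLex, S.lam_star, S.par_star, S.star_star] at h₁ h₂
  have hl : S.lam i = S.lam j := by
    rcases h₁ with h | h
    · rcases h₂ with h' | h'
      · exact absurd (h.trans h') (lt_irrefl _)
      · exact (OrderDual.toDual.injective h'.1).symm
    · exact OrderDual.toDual.injective h.1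
  simp only [hl, lt_self_iff_false, true_and, false_or] at h₁ h₂
  have hmin : min (g i) (g (S.star i)) = min (g j) (g (S.star j)) := by
    rw [min_comm (g (S.star i))] at h₂
    omega
  have : g i = g j ∨ g i = g (S.star j) ∨ g (S.star i) = g j ∨ g (S.star i) = g (S.star j) := by
    omega
  rcases this with h | h | h | h
  · exact Or.inl (hg h).symm
  · right; rw [hg h, S.star_star]
  · exact Or.inr (hg h).symm
  · left; rw [← S.star_star j, ← hg h, S.star_star]

/-- Pairing a relation with the dual vector `e^(λ_i - 1 - k) v_{i*}` isolates the coefficient of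
`e^k v_i`. -/
theorem linearIndependent (S : AdaptedStrings B e ι)
    (he : ∀ u w, B (e u) w = -B u (e w)) :
    LinearIndependent K (fun p : (i : ι) × Fin (S.lam i) => (e ^ (p.2 : ℕ)) (S.v p.1)) := by
  classical
  rw [linearIndependent_iff']
  rintro s g hg ⟨i, k⟩ hp
  have hs := S.lam_star i
  have hk : (k : ℕ) < S.lam i := k.2
  have h := congrArg (B ((e ^ (S.lam i - 1 - k)) (S.v (S.star i)))) hg
  rw [map_zero, map_sum, Finset.sum_eq_single ⟨i, k⟩, map_smul, smul_eq_mul] at h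
  · have h1 := S.form_eq_star (i := S.star i) he (a := S.lam i - 1 - k) (b := k) (by omega)
    rw [S.star_star] at h1
    rw [h1] at h
    refine (mul_eq_zero.1 h).resolve_right (mul_ne_zero (pow_ne_zero _ (by simp)) fun h0 => ?_)
    have := S.theta_mul_theta (K := K) (S.star i)
    rw [h0, mul_zero] at this
    exact zero_ne_one this
  · rintro ⟨j, l⟩ _ hne
    rw [map_smul, S.form_eq_of_ne he, smul_zero]
    rw [S.star_star]
    by_contra! hcon
    obtain ⟨rfl, hl⟩ := hcon
    have hl' : (l : ℕ) = k := by dsimp only at hl hk hs; omega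
    exact hne (by rw [Fin.ext hl'])
  · exact fun h => absurd hp h

theorem exists_ospJordanData [Fintype ι] (S : AdaptedStrings B e ι)
    (he : ∀ u w, B (e u) w = -B u (e w)) (𝒱 : ZMod 2 → Submodule K V)
    (hS : ∀ c, S.part c = 𝒱 c) : ∃ N : ℕ, Nonempty (OspJordanData 𝒱 B e N) := by
  classical
  let g : ι → ℕ := fun i => Fintype.equivFin ι i
  have hg : Function.Injective g := Fin.val_injective.comp (Fintype.equivFin ι).injective
  let : LinearOrder ι := LinearOrder.lift' (S.key g) (S.key_injective hg)
  have hle : ∀ i j : ι, i ≤ j ↔ S.key g i ≤ S.key g j := fun _ _ => Iff.rfl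
  have hlt : ∀ i j : ι, i < j ↔ S.key g i < S.key g j := fun _ _ => Iff.rfl
  let f : Fin (Fintype.card ι) ≃o ι := monoEquivOfFin ι rfl
  -- If the gap exceeded one, the string just after `i` would lie strictly between `i` and `i*`.
  have hnear : ∀ i, ((f.symm (S.star i)) : ℕ) ≤ (f.symm i : ℕ) + 1 := by
    intro i
    by_contra! h
    let m : Fin (Fintype.card ι) := ⟨f.symm i + 1, by omega⟩
    have h1 : f.symm i < m := by simp [m, Fin.lt_def]
    have h2 : m < f.symm (S.star i) := by simpa [m, Fin.lt_def] using h
    have h3 : i < f m := by simpa using f.strictMono h1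
    have h4 : f m < S.star i := by simpa using f.strictMono h2
    rcases S.eq_or_eq_star_of_key_between hg ((hle _ _).1 h3.le) ((hle _ _).1 h4.le) with h | h
    · exact h3.ne h.symm
    · exact h4.ne h
  refine ⟨Fintype.card ι, ⟨{
    lam := fun i => S.lam (f i)
    par := fun i => S.par (f i)
    v := fun i => S.v (f i)
    star := fun i => f.symm (S.star (f i))
    theta := fun i => S.theta (f i)
    lam_pos := fun i => S.lam_pos _
    lam_antitone := fun i j h => S.lam_le_of_key_le ((hle _ _).1 (f.monotone h))
    even_before_odd := fun i j h hi hj =>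
      f.lt_iff_lt.1 ((hlt _ _).2 (S.key_lt_of_par h hi hj))
    linearIndependent := (S.linearIndependent he).comp
      (fun p : (i : Fin (Fintype.card ι)) × Fin (S.lam (f i)) => ⟨f p.1, p.2⟩) ?_
    span_part := fun c => ?_
    pow_lam := fun i => S.pow_lam _
    star_star := fun i => by simp [S.star_star]
    star_near := ?_
    lam_star := fun i => by simp [S.lam_star]
    par_star := fun i => by simp [S.par_star]
    star_eq_of_even := fun i h h' => by simp [S.star_eq_of_even _ h h']
    star_eq_of_odd := fun i h h' => by simp [S.star_eq_of_odd _ h h']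
    form_eq := ?_ }⟩⟩
  · rintro ⟨i, k⟩ ⟨j, l⟩ h
    obtain rfl : i = j := f.injective (congrArg Sigma.fst h)
    simpa using h
  · rw [← hS c]
    refine le_antisymm (Submodule.span_mono ?_) (Submodule.span_mono ?_)
    · rintro _ ⟨i, hi, k, hk, rfl⟩
      exact ⟨f i, hi, k, hk, rfl⟩
    · rintro _ ⟨i, hi, k, hk, rfl⟩
      exact ⟨f.symm i, by simpa using hi, k, by simpa using hk, by simp⟩
  · rintro i _ rfl
    refine ⟨?_, ?_⟩
    · simpa [S.star_star] using hnear (S.star (f i))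
    · simpa using hnear (f i)
  · intro i j a b ha hb
    split_ifs with h
    · obtain ⟨rfl, h⟩ := h
      simpa using S.form_eq_star he h
    · refine S.form_eq_of_ne he ?_
      rw [← not_and_or]
      rintro ⟨h1, h2⟩
      exact h ⟨by simp [← h1], h2⟩

end AdaptedStrings

theorem zmod_two_eq_zero_or_one : ∀ c : ZMod 2, c = 0 ∨ c = 1 := by decide

theorem IsEvenSupersymmetric.symm_homogeneous {𝒱 : ZMod 2 → Submodule K V}
    (hB : IsEvenSupersymmetric 𝒱 B) {c : ZMod 2} {u w : V} (hu : u ∈ 𝒱 c)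
    (hw : w ∈ 𝒱 c) : B u w = (-1) ^ c.val * B w u := by
  obtain rfl | rfl := zmod_two_eq_zero_or_one c
  · simpa using hB.symm_even u hu w hw
  · simpa [ZMod.val_one] using hB.skew_odd u hu w hw

theorem form_skew_of_mem_ospPart {𝒱 : ZMod 2 → Submodule K V} [DirectSum.Decomposition 𝒱]
    (he : e ∈ ospPart 𝒱 B 0) (u w : V) : B (e u) w = -B u (e w) := by
  induction u using DirectSum.Decomposition.inductionOn 𝒱 with
  | zero => simp
  | add u u' h h' => simp only [map_add, LinearMap.add_apply, h, h', neg_add]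
  | @homogeneous c u =>
    induction w using DirectSum.Decomposition.inductionOn 𝒱 with
    | zero => simp
    | add w w' h h' => simp only [map_add, h, h', neg_add]
    | @homogeneous d w => simpa using he.2 c d u u.2 w w.2

theorem exists_ospJordanData_of_mem_ospPart [IsAlgClosed K] [FiniteDimensional K V]
    (h2 : (2 : K) ≠ 0) (𝒱 : ZMod 2 → Submodule K V) [DirectSum.Decomposition 𝒱]
    (hB : IsEvenSupersymmetric 𝒱 B) (hB' : B.Nondegenerate)
    (he : e ∈ ospPart 𝒱 B 0) (hnil : IsNilpotent e) :
    ∃ N : ℕ, Nonempty (OspJordanData 𝒱 B e N) := by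
  have hskew := form_skew_of_mem_ospPart he
  have hW : ∀ c, ∀ x ∈ 𝒱 c, e x ∈ 𝒱 c := fun c x hx => by simpa using he.1 c x hx
  have hs : ∀ c : ZMod 2, ∀ x ∈ 𝒱 c, ∀ y ∈ 𝒱 c, B x y = (-1) ^ c.val * B y x := by
    intro c x hx y hy
    exact hB.symm_homogeneous hx hy
  have hnd : ∀ c, ∀ x ∈ 𝒱 c, (∀ y ∈ 𝒱 c, B y x = 0) → x = 0 := by
    intro c x hx h
    refine hB'.2 x fun y => ?_
    induction y using DirectSum.Decomposition.inductionOn 𝒱 with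
    | zero => simp
    | add y y' h h' => simp only [map_add, LinearMap.add_apply, h, h', add_zero]
    | @homogeneous d y =>
      rcases eq_or_ne d c with rfl | hdc
      · exact h y y.2
      · exact hB.orthogonal d c hdc y y.2 x hx
  obtain ⟨ι, _, S, hSp, hS⟩ := exists_adaptedStrings h2 hskew hnil 0 (𝒱 0) (hW 0) (hs 0) (hnd 0)
  obtain ⟨κ, _, T, hTp, hT⟩ := exists_adaptedStrings h2 hskew hnil 1 (𝒱 1) (hW 1) (hs 1) (hnd 1)
  have hSm : ∀ i b, (e ^ b) (S.v i) ∈ 𝒱 0 := fun i b => by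
    rw [← hS, ← hSp i]; exact S.pow_mem_part i b
  have hTm : ∀ i b, (e ^ b) (T.v i) ∈ 𝒱 1 := fun i b => by
    rw [← hT, ← hTp i]; exact T.pow_mem_part i b
  refine (S.sum T
    (fun i j b => hB.orthogonal 0 1 (by decide) _ (by simpa using hSm i 0) _ (hTm j b))
    (fun i j b => hB.orthogonal 1 0 (by decide) _ (by simpa using hTm j 0) _
      (hSm i b))).exists_ospJordanData hskew 𝒱 fun c => ?_
  rw [S.sum_part]
  have hS1 : S.part 1 = ⊥ := eq_bot_iff.2 <| S.part_le 1 fun i hi => by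
    rw [hSp i] at hi; exact absurd hi (by decide)
  have hT0 : T.part 0 = ⊥ := eq_bot_iff.2 <| T.part_le 0 fun i hi => by
    rw [hTp i] at hi; exact absurd hi (by decide)
  obtain rfl | rfl := zmod_two_eq_zero_or_one c
  · rw [hS, hT0, sup_bot_eq]
  · rw [hT, hS1, bot_sup_eq]

end Existence

/-! ### Parity components, the superbracket and membership in `osp` -/

section Super

variable {K V : Type*} [Field K] [AddCommGroup V] [Module K V]
  {𝒱 : ZMod 2 → Submodule K V} [DirectSum.Decomposition 𝒱] {B : LinearMap.BilinForm K V}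

theorem superProj_of_mem {c d : ZMod 2} {v : V} (hv : v ∈ 𝒱 d) :
    superProj 𝒱 c v = if c = d then v else 0 := by
  have h : superProj 𝒱 c v = (DirectSum.decompose 𝒱 v c : V) := rfl
  rw [h]
  split_ifs with hcd
  · rw [hcd, DirectSum.decompose_of_mem_same 𝒱 hv]
  · rw [DirectSum.decompose_of_mem_ne 𝒱 hv (Ne.symm hcd)]

theorem superProj_mem (c : ZMod 2) (v : V) : superProj 𝒱 c v ∈ 𝒱 c :=
  (DirectSum.decompose 𝒱 v c).2

theorem sum_superProj : ∑ c : ZMod 2, superProj 𝒱 c = 1 := by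
  ext v
  induction v using DirectSum.Decomposition.inductionOn 𝒱 with
  | zero => simp
  | add u u' h h' => rw [map_add, h, h', map_add]
  | @homogeneous d u => simp [LinearMap.sum_apply, superProj_of_mem u.2]

theorem parityPart_apply {c d : ZMod 2} (x : End K V) {v : V} (hv : v ∈ 𝒱 d) :
    parityPart 𝒱 c x v = superProj 𝒱 (c + d) (x v) := by
  rw [parityPart, LinearMap.sum_apply, Finset.sum_eq_single d]
  · simp [superProj_of_mem hv]
  · intro d' _ hd'
    simp [superProj_of_mem hv, hd']
  · simp

theorem End.ext_homogeneous {x y : End K V} (h : ∀ d, ∀ v ∈ 𝒱 d, x v = y v) : x = y := by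
  ext v
  induction v using DirectSum.Decomposition.inductionOn 𝒱 with
  | zero => simp
  | add u u' h h' => rw [map_add, h, h', map_add]
  | @homogeneous d u => exact h d u u.2

theorem sum_parityPart (x : End K V) : ∑ c : ZMod 2, parityPart 𝒱 c x = x := by
  refine End.ext_homogeneous (𝒱 := 𝒱) fun d v hv => ?_
  rw [LinearMap.sum_apply]
  simp only [parityPart_apply x hv]
  refine (Equiv.sum_comp (Equiv.addRight d) (fun c => superProj 𝒱 c (x v))).trans ?_
  rw [← LinearMap.sum_apply, sum_superProj, Module.End.one_apply]

/-- All signs are trivial when one argument is even, so `[e, x]` is the ordinary commutator for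
every `x`, homogeneous or not. -/
theorem superBracket_of_mem_glPart_zero {e : End K V} (he : e ∈ glPart 𝒱 0) (x : End K V) :
    superBracket 𝒱 e x = e * x - x * e := by
  have h0 : parityPart 𝒱 0 e = e := End.ext_homogeneous (𝒱 := 𝒱) fun d v hv => by
    rw [parityPart_apply e hv, superProj_of_mem (he d v hv), if_pos rfl]
  have h1 : parityPart 𝒱 1 e = 0 := End.ext_homogeneous (𝒱 := 𝒱) fun d v hv => by
    rw [parityPart_apply e hv, superProj_of_mem (he d v hv), if_neg (by simp),
      LinearMap.zero_apply]
  rw [superBracket, Finset.sum_eq_single 0]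
  · simp only [h0, ZMod.val_zero, zero_mul, pow_zero, one_smul, Finset.sum_sub_distrib,
      ← Finset.mul_sum, ← Finset.sum_mul, sum_parityPart]
  · intro a _ ha
    obtain rfl := (zmod_two_eq_zero_or_one a).resolve_left ha
    simp [h1]
  · simp

namespace IsEvenSupersymmetric

theorem form_superProj_left (hB : IsEvenSupersymmetric 𝒱 B) {c d : ZMod 2} (u : V) {w : V}
    (hw : w ∈ 𝒱 d) : B (superProj 𝒱 c u) w = if c = d then B u w else 0 := by
  split_ifs with h
  · subst h
    conv_rhs => rw [← Module.End.one_apply (R := K) u, ← sum_superProj (𝒱 := 𝒱),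
      LinearMap.sum_apply, map_sum, LinearMap.sum_apply]
    rw [Finset.sum_eq_single c _ fun h => absurd (Finset.mem_univ c) h]
    intro a _ ha
    exact hB.orthogonal a c ha _ (superProj_mem a u) w hw
  · exact hB.orthogonal c d h _ (superProj_mem c u) w hw

theorem symm_of_mem_left (hB : IsEvenSupersymmetric 𝒱 B) {c : ZMod 2} {u : V} (hu : u ∈ 𝒱 c)
    (w : V) : B u w = (-1) ^ c.val * B w u := by
  induction w using DirectSum.Decomposition.inductionOn 𝒱 with
  | zero => simp
  | add w w' h h' => simp only [map_add, LinearMap.add_apply, h, h', mul_add]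
  | @homogeneous d w =>
    rcases eq_or_ne c d with rfl | hcd
    · exact hB.symm_homogeneous hu w.2
    · rw [hB.orthogonal c d hcd u hu w w.2, hB.orthogonal d c hcd.symm w w.2 u hu, mul_zero]

theorem form_superProj_right (hB : IsEvenSupersymmetric 𝒱 B) {c d : ZMod 2} (u : V) {w : V}
    (hw : w ∈ 𝒱 d) : B w (superProj 𝒱 c u) = if c = d then B w u else 0 := by
  rw [hB.symm_of_mem_left hw, hB.form_superProj_left u hw, hB.symm_of_mem_left hw u]
  split_ifs <;> simp

/-- Orthogonality of the two parts means only the component of `x` of parity `d + d'` enters either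
side, so one identity covers both parities and `x` need not be split. -/
theorem mem_osp_iff (hB : IsEvenSupersymmetric 𝒱 B) {x : End K V} :
    x ∈ osp 𝒱 B ↔ ∀ d d' : ZMod 2, ∀ v ∈ 𝒱 d, ∀ w ∈ 𝒱 d',
      B (x v) w = -((-1 : K) ^ ((d + d').val * d.val) * B v (x w)) := by
  have hadd : ∀ c d d' : ZMod 2, c + d = d' ↔ c = d + d' := by decide
  have hadd' : ∀ c d d' : ZMod 2, c + d' = d ↔ c = d + d' := by decide
  constructor
  · have key : ∀ c, ∀ x ∈ ospPart 𝒱 B c, ∀ d d' : ZMod 2, ∀ v ∈ 𝒱 d, ∀ w ∈ 𝒱 d',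
        B (x v) w = -((-1 : K) ^ ((d + d').val * d.val) * B v (x w)) := by
      intro c x hx d d' v hv w hw
      by_cases h : c = d + d'
      · rw [← h]; exact hx.2 d d' v hv w hw
      · rw [hB.orthogonal _ _ (mt (hadd c d d').1 h) _ (hx.1 d v hv) w hw,
          hB.orthogonal _ _ (Ne.symm (mt (hadd' c d d').1 h)) v hv _ (hx.1 d' w hw)]
        simp
    intro hx d d' v hv w hw
    obtain ⟨y, hy, z, hz, rfl⟩ := Submodule.mem_sup.1 hx
    simp only [LinearMap.add_apply, map_add, key 0 y hy d d' v hv w hw, key 1 z hz d d' v hv w hw]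
    ring
  · intro h
    have key : ∀ c, parityPart 𝒱 c x ∈ ospPart 𝒱 B c := by
      refine fun c => ⟨fun d v hv => ?_, fun d d' v hv w hw => ?_⟩
      · rw [parityPart_apply x hv]; exact superProj_mem _ _
      · rw [parityPart_apply x hv, parityPart_apply x hw, hB.form_superProj_left _ hw,
          hB.form_superProj_right _ hv]
        by_cases hc : c = d + d'
        · rw [if_pos ((hadd c d d').2 hc), if_pos ((hadd' c d d').2 hc), hc]
          exact h d d' v hv w hw
        · rw [if_neg (mt (hadd c d d').1 hc), if_neg (mt (hadd' c d d').1 hc)]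
          simp
    have hx := sum_parityPart (𝒱 := 𝒱) x
    rw [← hx]
    change ∑ c : Fin 2, _ ∈ _
    rw [Fin.sum_univ_two]
    exact Submodule.mem_sup.2 ⟨_, key 0, _, key 1, rfl⟩

end IsEvenSupersymmetric

end Super

/-! ### Coordinates on the centralizer of `e` in `gl(V)` -/

namespace OspJordanData

variable {K V : Type*} [Field K] [AddCommGroup V] [Module K V]
  {𝒱 : ZMod 2 → Submodule K V} {B : LinearMap.BilinForm K V}
  {e : End K V} {N : ℕ}

/-- The system of adapted strings underlying an `OspJordanData`. -/
def toAdaptedStrings (D : OspJordanData 𝒱 B e N) :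
    AdaptedStrings B e (Fin N) where
  lam := D.lam
  par := D.par
  v := D.v
  star := D.star
  theta := D.theta
  lam_pos := D.lam_pos
  pow_lam := D.pow_lam
  star_star := D.star_star
  lam_star := D.lam_star
  par_star := D.par_star
  star_eq_of_even := D.star_eq_of_even
  star_eq_of_odd := D.star_eq_of_odd
  form_star i b h := by
    have h1 := D.form_eq i (D.star i) 0 b (D.lam_pos i) (by rw [D.lam_star]; omega)
    simpa [h] using h1
  form_zero i j b h := by
    rcases lt_or_ge b (D.lam j) with hb | hb
    · have h1 := D.form_eq i j 0 b (D.lam_pos i) hb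
      rw [if_neg (by rw [zero_add]; exact not_and_or.2 h)] at h1
      simpa using h1
    · rw [pow_apply_eq_zero_of_le (D.pow_lam j) hb, map_zero]

variable (D : OspJordanData 𝒱 B e N)

theorem part_toAdaptedStrings (D : OspJordanData 𝒱 B e N) (c : ZMod 2) :
    D.toAdaptedStrings.part c = 𝒱 c := D.span_part c

theorem pow_mem (D : OspJordanData 𝒱 B e N) (i : Fin N) (k : ℕ) :
    (e ^ k) (D.v i) ∈ 𝒱 (D.par i) := by
  rw [← D.part_toAdaptedStrings]
  exact D.toAdaptedStrings.pow_mem_part i k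

theorem v_mem (D : OspJordanData 𝒱 B e N) (i : Fin N) : D.v i ∈ 𝒱 (D.par i) := D.pow_mem i 0

theorem eps_cast (D : OspJordanData 𝒱 B e N) (i j : Fin N) (k : ℕ) :
    ((D.eps i j k : ℤ) : K) = (-1) ^ (D.lam j) * (-1) ^ k *
      (-1) ^ ((D.par i + D.par j).val * (D.par i).val) *
      ((D.theta j : ℤ) : K) * ((D.theta i : ℤ) : K) := by
  rw [eps, zpow_sub, zpow_sub, zpow_natCast, zpow_natCast, zpow_natCast, Int.units_inv_eq_self,
    Int.units_inv_eq_self]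
  push_cast
  rfl

theorem eps_mul_eps (D : OspJordanData 𝒱 B e N) (i j : Fin N) (k : ℕ) :
    ((D.eps i j k : ℤ) : K) * ((D.eps i j k : ℤ) : K) = 1 := by
  rcases Int.units_eq_one_or (D.eps i j k) with h | h <;> simp [h]

/-- The triples `(i, j, k)` with `0 ≤ k ≤ min(λ_i, λ_j) - 1`. -/
noncomputable def triples (D : OspJordanData 𝒱 B e N) : Finset (Fin N × Fin N × ℕ) :=
  {t ∈ Finset.univ ×ˢ Finset.univ ×ˢ Finset.range (∑ i, D.lam i) |
    t.2.2 < D.lam t.1 ∧ t.2.2 < D.lam t.2.1}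

theorem mem_triples {D : OspJordanData 𝒱 B e N} {t : Fin N × Fin N × ℕ} :
    t ∈ D.triples ↔ t.2.2 < D.lam t.1 ∧ t.2.2 < D.lam t.2.1 := by
  simp only [triples, Finset.mem_filter, Finset.mem_product, Finset.mem_univ, true_and,
    Finset.mem_range, and_iff_right_iff_imp]
  exact fun h => h.1.trans_le (Finset.single_le_sum (fun _ _ => Nat.zero_le _) (Finset.mem_univ _))

theorem flip_mem_triples {D : OspJordanData 𝒱 B e N} {t : Fin N × Fin N × ℕ}
    (ht : t ∈ D.triples) : D.flip t ∈ D.triples := by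
  rw [mem_triples] at ht ⊢
  simp only [flip, D.lam_star]
  exact ht.symm

theorem flip_flip (D : OspJordanData 𝒱 B e N) (t : Fin N × Fin N × ℕ) : D.flip (D.flip t) = t := by
  simp [flip, D.star_star]

theorem flip_eq_iff (D : OspJordanData 𝒱 B e N) {t t' : Fin N × Fin N × ℕ} :
    D.flip t = t' ↔ t = D.flip t' :=
  ⟨fun h => by rw [← h, flip_flip], fun h => by rw [h, flip_flip]⟩

theorem flip_eq_self_iff (D : OspJordanData 𝒱 B e N) {t : Fin N × Fin N × ℕ} :
    D.flip t = t ↔ D.star t.1 = t.2.1 := by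
  obtain ⟨i, j, k⟩ := t
  simp only [flip, Prod.mk.injEq, and_true]
  exact ⟨fun h => h.2, fun h => ⟨by rw [← h, D.star_star], h⟩⟩

/-- The coefficient of `ξ_i^{j, λ_j - 1 - k}` in an element of the centralizer of `e`. -/
noncomputable def coef (t : Fin N × Fin N × ℕ) : End K V →ₗ[K] K :=
  ((-1) ^ (D.lam t.2.1 - 1 - t.2.2) * ((D.theta t.2.1 : ℤ) : K)) •
    (B.flip ((e ^ t.2.2) (D.v (D.star t.2.1)))).comp (LinearMap.applyₗ (D.v t.1))

theorem coef_apply (D : OspJordanData 𝒱 B e N) (t : Fin N × Fin N × ℕ) (x : End K V) :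
    D.coef t x = (-1) ^ (D.lam t.2.1 - 1 - t.2.2) * ((D.theta t.2.1 : ℤ) : K) *
      B (x (D.v t.1)) ((e ^ t.2.2) (D.v (D.star t.2.1))) := rfl

/-- If `k ≥ λ_j` then `e^k` kills `v_{j*}`; if `k ≥ λ_i`, it can be moved through `x` onto `v_i`. -/
theorem form_apply_eq_zero (he : ∀ u w, B (e u) w = -B u (e w)) {x : End K V}
    (hx : e * x = x * e) {i j : Fin N} {k : ℕ} (hk : ¬(k < D.lam i ∧ k < D.lam j)) :
    B (x (D.v i)) ((e ^ k) (D.v (D.star j))) = 0 := by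
  rcases lt_or_ge k (D.lam j) with hj | hj
  · have hx' : Commute (e ^ k) x := (show Commute e x from hx).pow_left _
    have h := form_pow_left he k (x (D.v i)) (D.v (D.star j))
    rw [← Module.End.mul_apply, hx'.eq, Module.End.mul_apply,
      pow_apply_eq_zero_of_le (D.pow_lam i) (by omega), map_zero, map_zero,
      LinearMap.zero_apply] at h
    exact (mul_eq_zero.1 h.symm).resolve_left (pow_ne_zero _ (by simp))
  · rw [pow_apply_eq_zero_of_le (D.pow_lam (D.star j)) (by rwa [D.lam_star]), map_zero]

theorem theta_mul_theta (D : OspJordanData 𝒱 B e N) (i : Fin N) :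
    ((D.theta i : ℤ) : K) * ((D.theta i : ℤ) : K) = 1 := D.toAdaptedStrings.theta_mul_theta i

theorem sign_ne_zero (D : OspJordanData 𝒱 B e N) (n : ℕ) (i : Fin N) :
    (-1 : K) ^ n * ((D.theta i : ℤ) : K) ≠ 0 := by
  refine mul_ne_zero (pow_ne_zero _ (by simp)) fun h => ?_
  have := D.theta_mul_theta i
  rw [h, mul_zero] at this
  exact zero_ne_one this

/-- The sign `ε_t` as an element of `K`. -/
def sgn (t : Fin N × Fin N × ℕ) : K := ((D.eps t.1 t.2.1 t.2.2 : ℤ) : K)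

theorem sgn_mul_sgn (t : Fin N × Fin N × ℕ) : D.sgn t * D.sgn t = 1 := D.eps_mul_eps _ _ _

theorem mem_idx2_iff {t : Fin N × Fin N × ℕ} :
    t ∈ D.idx2 ↔ t ∈ D.triples ∧ D.flip t ≠ t := by
  rw [mem_triples, ne_eq, flip_eq_self_iff, ← lt_min_iff]
  rfl

theorem flip_mem_idx2 {t : Fin N × Fin N × ℕ} (ht : t ∈ D.idx2) : D.flip t ∈ D.idx2 := by
  rw [mem_idx2_iff] at ht ⊢
  exact ⟨flip_mem_triples ht.1, fun h => ht.2 (by rwa [flip_flip, eq_comm] at h)⟩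

theorem star_mem_triples {p : Fin N × ℕ} (hp : p.2 < D.lam p.1) :
    (p.1, D.star p.1, p.2) ∈ D.triples := by
  rw [mem_triples]
  exact ⟨hp, by rwa [D.lam_star]⟩

theorem form_commute_pow_pow (he : ∀ u w, B (e u) w = -B u (e w)) {x : End K V}
    (hx : e * x = x * e) (a b : ℕ) (u w : V) :
    B (x ((e ^ a) u)) ((e ^ b) w) = (-1) ^ a * B (x u) ((e ^ (a + b)) w) := by
  have hx' : Commute (e ^ a) x := (show Commute e x from hx).pow_left _
  rw [← Module.End.mul_apply, ← hx'.eq, Module.End.mul_apply, form_pow_pow he]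

variable [DirectSum.Decomposition 𝒱]

theorem basis_apply (p : (i : Fin N) × Fin (D.lam i)) :
    D.basis p = (e ^ (p.2 : ℕ)) (D.v p.1) := Basis.mk_apply _ _ _

theorem ext_of_commute {x y : End K V} (hx : e * x = x * e) (hy : e * y = y * e)
    (h : ∀ i, x (D.v i) = y (D.v i)) : x = y := by
  refine D.basis.ext fun p => ?_
  have hx' : Commute (e ^ (p.2 : ℕ)) x := (show Commute e x from hx).pow_left _
  have hy' : Commute (e ^ (p.2 : ℕ)) y := (show Commute e y from hy).pow_left _
  rw [D.basis_apply, ← Module.End.mul_apply, ← Module.End.mul_apply, ← hx'.eq, ← hy'.eq,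
    Module.End.mul_apply, Module.End.mul_apply, h]

/-- Compare the two orders of the pairing of `v_i` with `e^(λ_i - 1) v_{i*}`. -/
theorem theta_eq_theta_star (hB : IsEvenSupersymmetric 𝒱 B) (he : ∀ u w, B (e u) w = -B u (e w))
    (i : Fin N) : ((D.theta i : ℤ) : K) =
      (-1) ^ (D.par i).val * (-1) ^ (D.lam i - 1) * ((D.theta (D.star i) : ℤ) : K) := by
  have hl := D.lam_pos i
  have h1 := D.toAdaptedStrings.form_star i (D.lam i - 1) (Nat.sub_add_cancel hl)
  have h2 := D.toAdaptedStrings.form_eq_star he (i := D.star i) (a := D.lam i - 1) (b := 0)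
    (by change _ = D.lam (D.star i); rw [D.lam_star]; omega)
  change B _ ((e ^ 0) (D.v (D.star (D.star i)))) = (-1) ^ (D.lam i - 1) * _ at h2
  rw [D.star_star] at h2
  change _ = ((D.theta i : ℤ) : K) at h1
  rw [← h1, mul_assoc]
  change _ = _ * ((-1) ^ (D.lam i - 1) * ((D.toAdaptedStrings.theta (D.star i) : ℤ) : K))
  rw [← h2]
  exact hB.symm_of_mem_left (D.v_mem i) _

theorem eps_flip (hB : IsEvenSupersymmetric 𝒱 B) (he : ∀ u w, B (e u) w = -B u (e w))
    (i j : Fin N) (k : ℕ) :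
    ((D.eps (D.star j) (D.star i) k : ℤ) : K) = ((D.eps i j k : ℤ) : K) := by
  rw [eps_cast, eps_cast, D.lam_star, D.par_star, D.par_star, D.theta_eq_theta_star hB he i,
    D.theta_eq_theta_star hB he j]
  obtain ⟨a, ha⟩ := Nat.exists_eq_succ_of_ne_zero (D.lam_pos i).ne'
  obtain ⟨b, hb⟩ := Nat.exists_eq_succ_of_ne_zero (D.lam_pos j).ne'
  rw [ha, hb]
  simp only [Nat.succ_eq_add_one, Nat.add_sub_cancel, pow_succ]
  have h1 : (1 : ZMod 2) + 1 = 0 := by decide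
  rcases zmod_two_eq_zero_or_one (D.par i) with hi | hi <;>
  rcases zmod_two_eq_zero_or_one (D.par j) with hj | hj <;>
  rcases neg_one_pow_eq_or K a with h | h <;> rcases neg_one_pow_eq_or K b with h' | h' <;>
  simp only [hi, hj, h, h', h1, ZMod.val_zero, ZMod.val_one, add_zero, zero_add, pow_zero,
    pow_one, mul_zero, mul_one] <;> ring

/-- This sign at the fixed triples of `flip` is what separates `S₀` and `S₁` from the indices that
contribute nothing. -/
theorem eps_star (hB : IsEvenSupersymmetric 𝒱 B) (he : ∀ u w, B (e u) w = -B u (e w))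
    (i : Fin N) (k : ℕ) :
    ((D.eps i (D.star i) k : ℤ) : K) = -((-1) ^ (D.par i).val * (-1) ^ k) := by
  have h1 : D.par i + D.par i = 0 := by
    rcases zmod_two_eq_zero_or_one (D.par i) with h | h <;> rw [h] <;> decide
  have h2 := D.theta_mul_theta (D.star i)
  obtain ⟨a, ha⟩ := Nat.exists_eq_succ_of_ne_zero (D.lam_pos i).ne'
  have h3 : ((-1 : K) ^ a) * (-1) ^ a = 1 := by rw [← mul_pow]; simp
  rw [eps_cast, D.lam_star, D.par_star, h1, D.theta_eq_theta_star hB he i, ha]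
  simp only [Nat.succ_eq_add_one, Nat.add_sub_cancel, pow_succ, ZMod.val_zero, zero_mul, pow_zero]
  linear_combination (-(-1) ^ (D.par i).val * (-1) ^ k) * h3
    - (-1) ^ (D.par i).val * (-1) ^ k * (-1) ^ a * (-1) ^ a * h2

/-- The bound on `k` gives `e^(λ_i + k) v_j = 0`, so the formula stays valid past the end of the
string of `v_i`; commutation with `e` follows. -/
theorem xi_apply_pow {i j : Fin N} {k : ℕ} (hk : D.lam j ≤ D.lam i + k) (t : Fin N) (a : ℕ) :
    D.xi i j k ((e ^ a) (D.v t)) = if t = i then (e ^ (a + k)) (D.v j) else 0 := by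
  rcases lt_or_ge a (D.lam t) with ha | ha
  · have h := D.basis.constr_basis K
      (fun p => if p.1 = i then (e ^ (p.2 : ℕ)) ((e ^ k) (D.v j)) else 0) ⟨t, ⟨a, ha⟩⟩
    rw [D.basis_apply] at h
    rw [pow_add]
    exact h
  · rw [pow_apply_eq_zero_of_le (D.pow_lam t) ha, map_zero]
    split_ifs with h
    · subst h
      rw [pow_apply_eq_zero_of_le (D.pow_lam j) (by omega)]
    · rfl

theorem commute_xi {i j : Fin N} {k : ℕ} (hk : D.lam j ≤ D.lam i + k) :
    e * D.xi i j k = D.xi i j k * e := by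
  refine D.basis.ext fun p => ?_
  rw [D.basis_apply, Module.End.mul_apply, Module.End.mul_apply, D.xi_apply_pow hk,
    ← Module.End.mul_apply e, ← pow_succ', D.xi_apply_pow hk]
  split_ifs
  · rw [← Module.End.mul_apply, ← pow_succ', add_right_comm]
  · rw [map_zero]

/-- The element `ξ_i^{j, λ_j - 1 - k}` for `t = (i, j, k)`. -/
noncomputable def xiOf (t : Fin N × Fin N × ℕ) : End K V :=
  D.xi t.1 t.2.1 (D.lam t.2.1 - 1 - t.2.2)

theorem coef_xiOf (he : ∀ u w, B (e u) w = -B u (e w)) {t t' : Fin N × Fin N × ℕ}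
    (ht : t ∈ D.triples) (ht' : t' ∈ D.triples) :
    D.coef t (D.xiOf t') = if t = t' then 1 else 0 := by
  obtain ⟨i, j, k⟩ := t
  obtain ⟨i', j', k'⟩ := t'
  rw [mem_triples] at ht ht'
  dsimp only at ht ht'
  have h1 := D.xi_apply_pow (i := i') (j := j') (k := D.lam j' - 1 - k') (by omega) i 0
  rw [pow_zero, Module.End.one_apply, zero_add] at h1
  rw [coef_apply]
  simp only [xiOf, h1]
  by_cases hi : i = i'
  · rw [if_pos hi]
    by_cases hjk : j = j' ∧ k = k'
    · obtain ⟨rfl, rfl⟩ := hjk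
      have h2 := D.toAdaptedStrings.form_eq_star he (i := j) (a := D.lam j - 1 - k) (b := k)
        (by change _ = D.lam j; omega)
      change B _ ((e ^ k) (D.v (D.star j))) = (-1) ^ (D.lam j - 1 - k) * _ at h2
      change B ((e ^ (D.lam j - 1 - k)) (D.v j)) _ = _ at h2
      rw [if_pos (by rw [hi]), h2]
      have h3 : ((-1 : K) ^ (D.lam j - 1 - k)) * (-1) ^ (D.lam j - 1 - k) = 1 := by
        rw [← mul_pow]; simp
      have h4 := D.theta_mul_theta j
      change _ * ((-1) ^ (D.lam j - 1 - k) * ((D.theta j : ℤ) : K)) = 1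
      linear_combination ((D.theta j : ℤ) : K) * ((D.theta j : ℤ) : K) * h3 + h4
    · have h2 := D.toAdaptedStrings.form_eq_of_ne he (i := j') (j := D.star j)
        (a := D.lam j' - 1 - k') (b := k) (by
          change D.star j ≠ D.star j' ∨ _ ≠ D.lam j'
          by_contra! h
          have hj : j = j' := by rw [← D.star_star j, h.1, D.star_star]
          subst hj
          exact hjk ⟨rfl, by omega⟩)
      change B ((e ^ (D.lam j' - 1 - k')) (D.v j')) ((e ^ k) (D.v (D.star j))) = 0 at h2
      rw [h2, mul_zero, if_neg]
      simp only [Prod.mk.injEq]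
      tauto
  · rw [if_neg hi, map_zero, LinearMap.zero_apply, mul_zero, if_neg]
    simp only [Prod.mk.injEq]
    tauto

/-- The coordinates are, up to sign, the pairings of `x v_i` with basis vectors; those not indexed
by `triples` vanish by `form_apply_eq_zero`. -/
theorem eq_zero_of_coef (he : ∀ u w, B (e u) w = -B u (e w)) (hB' : B.Nondegenerate)
    {x : End K V} (hx : e * x = x * e) (h : ∀ t ∈ D.triples, D.coef t x = 0) : x = 0 := by
  refine D.ext_of_commute hx (by simp) fun i => ?_
  rw [LinearMap.zero_apply]
  refine hB'.1 _ fun w => ?_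
  have : B (x (D.v i)) = 0 := by
    refine D.basis.ext fun p => ?_
    rw [D.basis_apply, LinearMap.zero_apply]
    generalize p.1 = j, (p.2 : ℕ) = k
    rw [← D.star_star j]
    by_cases hk : k < D.lam i ∧ k < D.lam (D.star j)
    · have h1 := h (i, D.star j, k) (mem_triples.2 hk)
      rw [coef_apply] at h1
      exact (mul_eq_zero.1 h1).resolve_left (D.sign_ne_zero _ _)
    · exact D.form_apply_eq_zero he hx hk
  rw [this, LinearMap.zero_apply]

theorem commute_xiOf {t : Fin N × Fin N × ℕ} (ht : t ∈ D.triples) :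
    e * D.xiOf t = D.xiOf t * e := by
  rw [mem_triples] at ht
  exact D.commute_xi (by omega)

theorem eq_sum_coef_smul (he : ∀ u w, B (e u) w = -B u (e w)) (hB' : B.Nondegenerate)
    {x : End K V} (hx : e * x = x * e) : x = ∑ t ∈ D.triples, D.coef t x • D.xiOf t := by
  rw [← sub_eq_zero]
  refine D.eq_zero_of_coef he hB' ?_ fun t ht => ?_
  · rw [mul_sub, sub_mul, hx, Finset.mul_sum, Finset.sum_mul]
    congr 1
    refine Finset.sum_congr rfl fun t ht => ?_
    rw [mul_smul_comm, smul_mul_assoc, D.commute_xiOf ht]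
  · rw [map_sub, map_sum, Finset.sum_eq_single t, map_smul, D.coef_xiOf he ht ht, if_pos rfl,
      smul_eq_mul, mul_one, sub_self]
    · intro t' ht' hne
      rw [map_smul, D.coef_xiOf he ht ht', if_neg hne.symm, smul_zero]
    · exact fun h => absurd ht h

/-- The relation between `coef (flip t)` and `coef t` expresses the invariance of the form. -/
theorem coef_flip_sub (hB : IsEvenSupersymmetric 𝒱 B) (he : ∀ u w, B (e u) w = -B u (e w))
    (x : End K V) {i j : Fin N} {k : ℕ} (ht : (i, j, k) ∈ D.triples) :
    D.coef (D.flip (i, j, k)) x - ((D.eps i j k : ℤ) : K) * D.coef (i, j, k) x =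
      -(((D.eps i j k : ℤ) : K) * ((-1) ^ (D.lam j - 1 - k) * ((D.theta j : ℤ) : K))) *
        (B (x (D.v i)) ((e ^ k) (D.v (D.star j))) +
          (-1) ^ ((D.par i + D.par j).val * (D.par i).val) * (-1) ^ k * (-1) ^ (D.par i).val *
            B (x (D.v (D.star j))) ((e ^ k) (D.v i))) := by
  rw [mem_triples] at ht
  dsimp only at ht
  rw [coef_apply, coef_apply, eps_cast]
  simp only [flip, D.star_star, D.lam_star]
  have hθ := D.theta_eq_theta_star hB he (D.star i)
  rw [D.star_star, D.par_star, D.lam_star] at hθ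
  -- Writing both lengths as `_ + 1 + k` removes truncated subtraction; what remains is an identity
  -- modulo squares of signs being 1.
  obtain ⟨a, ha⟩ : ∃ a, D.lam i = a + 1 + k := ⟨D.lam i - 1 - k, by omega⟩
  obtain ⟨b, hb⟩ : ∃ b, D.lam j = b + 1 + k := ⟨D.lam j - 1 - k, by omega⟩
  have h1 : D.lam i - 1 = a + k := by omega
  have h2 : a + k - k = a := by omega
  have h3 : D.lam j - 1 - k = b := by omega
  have h4 := D.theta_mul_theta j
  rw [hθ, h1, h2, h3, hb]
  simp only [pow_add, pow_one]
  have hsq : ∀ n : ℕ, ((-1 : K) ^ n) * (-1) ^ n = 1 := fun n => by rw [← mul_pow]; simp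
  have hc := hsq ((D.par i + D.par j).val * (D.par i).val)
  generalize (-1 : K) ^ ((D.par i + D.par j).val * (D.par i).val) = c at *
  linear_combination ((-1) ^ (D.par i).val * (-1) ^ k * ((D.theta i : ℤ) : K) *
    B (x (D.v (D.star j))) ((e ^ k) (D.v i))) * (hsq a
      - (-1) ^ k * (-1) ^ k * (c * c * ((D.theta j : ℤ) : K) * ((D.theta j : ℤ) : K)) * hsq b
      - c * c * ((D.theta j : ℤ) : K) * ((D.theta j : ℤ) : K) * hsq k
      - ((D.theta j : ℤ) : K) * ((D.theta j : ℤ) : K) * hc - h4)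

end OspJordanData

/-! ### The signed involution on coordinates, and the basis of `𝔤^e` -/

namespace OspJordanData

variable {K V : Type*} [Field K] [AddCommGroup V] [Module K V]
  {𝒱 : ZMod 2 → Submodule K V} {B : LinearMap.BilinForm K V} {e : End K V} {N : ℕ}
  [DirectSum.Decomposition 𝒱] (D : OspJordanData 𝒱 B e N)

theorem coef_flip_iff (hB : IsEvenSupersymmetric 𝒱 B) (he : ∀ u w, B (e u) w = -B u (e w))
    (x : End K V) {i j : Fin N} {k : ℕ} (ht : (i, j, k) ∈ D.triples) :
    D.coef (D.flip (i, j, k)) x = ((D.eps i j k : ℤ) : K) * D.coef (i, j, k) x ↔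
      B (x (D.v i)) ((e ^ k) (D.v (D.star j))) =
        -((-1) ^ ((D.par i + D.par j).val * (D.par i).val) * (-1) ^ k * (-1) ^ (D.par i).val *
            B (x (D.v (D.star j))) ((e ^ k) (D.v i))) := by
  have hε : ((D.eps i j k : ℤ) : K) ≠ 0 := fun h => by
    have := D.eps_mul_eps i j k
    rw [h, mul_zero] at this
    exact zero_ne_one this
  rw [← sub_eq_zero, D.coef_flip_sub hB he x ht, mul_eq_zero, eq_neg_iff_add_eq_zero]
  exact or_iff_right (neg_ne_zero.2 (mul_ne_zero hε (D.sign_ne_zero _ _)))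

/-- Since `x` commutes with `e` and `e` is skew, powers of `e` can be moved off the left argument,
so testing on `v_i` and `e^k v_{j*}` suffices. -/
theorem mem_osp_iff_form (hB : IsEvenSupersymmetric 𝒱 B) (he : ∀ u w, B (e u) w = -B u (e w))
    {x : End K V} (hx : e * x = x * e) :
    x ∈ osp 𝒱 B ↔ ∀ i j k, B (x (D.v i)) ((e ^ k) (D.v (D.star j))) =
        -((-1) ^ ((D.par i + D.par j).val * (D.par i).val) * (-1) ^ k * (-1) ^ (D.par i).val *
            B (x (D.v (D.star j))) ((e ^ k) (D.v i))) := by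
  have hswap : ∀ i j (a b : ℕ), B ((e ^ a) (D.v i)) (x ((e ^ b) (D.v (D.star j)))) =
      (-1) ^ (D.par i).val * ((-1) ^ b * B (x (D.v (D.star j))) ((e ^ (a + b)) (D.v i))) := by
    intro i j a b
    rw [hB.symm_of_mem_left (D.pow_mem i a), form_commute_pow_pow he hx, add_comm b a]
  rw [hB.mem_osp_iff]
  constructor
  · intro h i j k
    have h1 := h _ _ _ (D.v_mem i) _ (D.pow_mem (D.star j) k)
    rw [D.par_star] at h1
    have h2 := hswap i j 0 k
    rw [pow_zero, Module.End.one_apply, zero_add] at h2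
    rw [h1, h2]
    ring
  · intro h d d' v hv w hw
    rw [← D.span_part] at hv hw
    induction hv using Submodule.span_induction with
    | zero => simp
    | add v v' _ _ ih ih' =>
      simp only [map_add, LinearMap.add_apply, ih, ih']
      ring
    | smul a v _ ih =>
      simp only [map_smul, LinearMap.smul_apply, ih, smul_eq_mul]
      ring
    | mem v hv =>
      obtain ⟨i, rfl, a, _, rfl⟩ := hv
      induction hw using Submodule.span_induction with
      | zero => simp
      | add v v' _ _ ih ih' =>
        simp only [map_add, ih, ih']
        ring
      | smul a v _ ih =>
        simp only [map_smul, ih, smul_eq_mul]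
        ring
      | mem w hw =>
        obtain ⟨j, rfl, b, _, rfl⟩ := hw
        have h1 := h i (D.star j) (a + b)
        have h2 := hswap i (D.star j) a b
        rw [D.star_star] at h1 h2
        rw [D.par_star] at h1
        have hsq : ((-1 : K) ^ a) * (-1) ^ a = 1 := by rw [← mul_pow]; simp
        rw [form_commute_pow_pow he hx, h1, h2, pow_add]
        linear_combination (-(-1) ^ ((D.par i + D.par j).val * (D.par i).val) *
          (-1) ^ (D.par i).val * (-1) ^ b *
            B (x (D.v j)) ((e ^ (a + b)) (D.v i))) * hsq

theorem mem_ospCentralizer_iff (hB : IsEvenSupersymmetric 𝒱 B) (he : e ∈ ospPart 𝒱 B 0)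
    {x : End K V} :
    x ∈ ospCentralizer 𝒱 B e ↔
      e * x = x * e ∧ ∀ t ∈ D.triples, D.coef (D.flip t) x = D.sgn t * D.coef t x := by
  have hs := form_skew_of_mem_ospPart he
  change x ∈ osp 𝒱 B ∧ superBracket 𝒱 e x = 0 ↔ _
  rw [superBracket_of_mem_glPart_zero he.1, sub_eq_zero, and_comm]
  refine and_congr_right fun hx => ?_
  rw [D.mem_osp_iff_form hB hs hx]
  constructor
  · rintro h ⟨i, j, k⟩ ht
    exact (D.coef_flip_iff hB hs x ht).2 (h i j k)
  · intro h i j k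
    by_cases ht : (i, j, k) ∈ D.triples
    · exact (D.coef_flip_iff hB hs x ht).1 (h _ ht)
    · rw [mem_triples] at ht
      have h1 := D.form_apply_eq_zero hs hx (i := D.star j) (j := D.star i) (k := k)
        (by rw [D.lam_star, D.lam_star, and_comm]; exact ht)
      rw [D.star_star] at h1
      rw [D.form_apply_eq_zero hs hx ht, h1]
      simp

theorem sgn_flip (hB : IsEvenSupersymmetric 𝒱 B) (he : ∀ u w, B (e u) w = -B u (e w))
    (t : Fin N × Fin N × ℕ) : D.sgn (D.flip t) = D.sgn t := D.eps_flip hB he t.1 t.2.1 t.2.2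

theorem elt2_eq (t : Fin N × Fin N × ℕ) :
    D.elt2 t = D.xiOf t + D.sgn t • D.xiOf (D.flip t) := by
  simp only [elt2, xiOf, flip, D.lam_star, sgn]

theorem elt01_eq (p : Fin N × ℕ) : D.elt01 p = D.xiOf (p.1, D.star p.1, p.2) := by
  simp only [elt01, xiOf, D.lam_star]

/-- Multiplying `ξ_t + ε_t ξ_{flip t}` by `ε_t` swaps its two terms, because `ε_t^2 = 1` and `ε` is
`flip`-invariant. -/
theorem elt2_flip (hB : IsEvenSupersymmetric 𝒱 B) (he : ∀ u w, B (e u) w = -B u (e w))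
    (t : Fin N × Fin N × ℕ) : D.elt2 (D.flip t) = D.sgn t • D.elt2 t := by
  rw [elt2_eq, elt2_eq, flip_flip, D.sgn_flip hB he, smul_add, smul_smul, sgn_mul_sgn, one_smul,
    add_comm]

theorem sgn_eq_one (hB : IsEvenSupersymmetric 𝒱 B) (he : ∀ u w, B (e u) w = -B u (e w))
    {p : Fin N × ℕ} (hp : p ∈ D.idx0 ∨ p ∈ D.idx1) : D.sgn (p.1, D.star p.1, p.2) = 1 := by
  rw [sgn, D.eps_star hB he]
  rcases hp with ⟨_, h1, h2⟩ | ⟨_, h1, h2⟩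
  · simp [h1, h2.neg_one_pow]
  · simp [h1, h2.neg_one_pow, ZMod.val_one]

theorem sgn_eq_neg_one (hB : IsEvenSupersymmetric 𝒱 B) (he : ∀ u w, B (e u) w = -B u (e w))
    {p : Fin N × ℕ} (hp : p.2 < D.lam p.1) (h0 : p ∉ D.idx0) (h1 : p ∉ D.idx1) :
    D.sgn (p.1, D.star p.1, p.2) = -1 := by
  rw [sgn, D.eps_star hB he]
  rcases zmod_two_eq_zero_or_one (D.par p.1) with h | h
  · have h2 : Even p.2 := Nat.not_odd_iff_even.1 fun h2 => h0 ⟨hp, h, h2⟩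
    simp [h, h2.neg_one_pow]
  · have h2 : Odd p.2 := Nat.not_even_iff_odd.1 fun h2 => h1 ⟨hp, h, h2⟩
    simp [h, h2.neg_one_pow, ZMod.val_one]

theorem coef_elt2 (he : ∀ u w, B (e u) w = -B u (e w)) {t t' : Fin N × Fin N × ℕ}
    (ht : t ∈ D.triples) (ht' : t' ∈ D.triples) :
    D.coef t (D.elt2 t') = (if t = t' then 1 else 0) + D.sgn t' * if t = D.flip t' then 1 else 0 := by
  rw [elt2_eq, map_add, map_smul, D.coef_xiOf he ht ht',
    D.coef_xiOf he ht (flip_mem_triples ht'), smul_eq_mul]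

theorem coef_elt01 (he : ∀ u w, B (e u) w = -B u (e w)) {t : Fin N × Fin N × ℕ} {p : Fin N × ℕ}
    (ht : t ∈ D.triples) (hp : p.2 < D.lam p.1) :
    D.coef t (D.elt01 p) = if t = (p.1, D.star p.1, p.2) then 1 else 0 := by
  rw [elt01_eq, D.coef_xiOf he ht (D.star_mem_triples hp)]

theorem elt2_mem (hB : IsEvenSupersymmetric 𝒱 B) (he : e ∈ ospPart 𝒱 B 0)
    {t : Fin N × Fin N × ℕ} (ht : t ∈ D.triples) : D.elt2 t ∈ ospCentralizer 𝒱 B e := by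
  have hs := form_skew_of_mem_ospPart he
  rw [D.mem_ospCentralizer_iff hB he]
  constructor
  · rw [elt2_eq, mul_add, add_mul, mul_smul_comm, smul_mul_assoc, D.commute_xiOf ht,
      D.commute_xiOf (flip_mem_triples ht)]
  · intro t' ht'
    rw [D.coef_elt2 hs (flip_mem_triples ht') ht, D.coef_elt2 hs ht' ht]
    simp only [D.flip_eq_iff, flip_flip]
    by_cases h1 : t' = t
    · subst h1
      by_cases h2 : t' = D.flip t'
      · rw [if_pos h2, if_pos rfl]
        linear_combination -D.sgn_mul_sgn t'
      · rw [if_neg h2, if_pos rfl]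
        ring
    · by_cases h2 : t' = D.flip t
      · rw [if_neg h1, if_pos h2, h2]
        rw [D.sgn_flip hB hs t]
        linear_combination -D.sgn_mul_sgn t
      · rw [if_neg h1, if_neg h2]
        ring

theorem elt01_mem (hB : IsEvenSupersymmetric 𝒱 B) (he : e ∈ ospPart 𝒱 B 0)
    {p : Fin N × ℕ} (hp : p ∈ D.idx0 ∨ p ∈ D.idx1) : D.elt01 p ∈ ospCentralizer 𝒱 B e := by
  have hs := form_skew_of_mem_ospPart he
  have hlt : p.2 < D.lam p.1 := hp.elim And.left And.left
  have hf : D.flip (p.1, D.star p.1, p.2) = (p.1, D.star p.1, p.2) := D.flip_eq_self_iff.2 rfl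
  rw [D.mem_ospCentralizer_iff hB he]
  constructor
  · rw [elt01_eq, D.commute_xiOf (D.star_mem_triples hlt)]
  · intro t ht
    rw [D.coef_elt01 hs (flip_mem_triples ht) hlt, D.coef_elt01 hs ht hlt]
    simp only [D.flip_eq_iff, hf]
    split_ifs with h
    · have := D.sgn_eq_one hB hs hp
      rw [h, this, mul_one]
    · rw [mul_zero]

theorem span_S (h2 : (2 : K) ≠ 0) (hB : IsEvenSupersymmetric 𝒱 B) (hB' : B.Nondegenerate)
    (he : e ∈ ospPart 𝒱 B 0) :
    Submodule.span K (D.S0 ∪ D.S1 ∪ D.S2) = ospCentralizer 𝒱 B e := by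
  have hs := form_skew_of_mem_ospPart he
  apply le_antisymm
  · refine Submodule.span_le.2 ?_
    rintro _ ((⟨p, hp, rfl⟩ | ⟨p, hp, rfl⟩) | ⟨t, ht, rfl⟩)
    · exact D.elt01_mem hB he (Or.inl hp)
    · exact D.elt01_mem hB he (Or.inr hp)
    · exact D.elt2_mem hB he (D.mem_idx2_iff.1 ht).1
  · intro x hx
    obtain ⟨hxe, hxc⟩ := (D.mem_ospCentralizer_iff hB he).1 hx
    have hsum := D.eq_sum_coef_smul hs hB' hxe
    have hsum' : x = ∑ t ∈ D.triples, D.coef (D.flip t) x • D.xiOf (D.flip t) := by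
      conv_lhs => rw [hsum]
      exact Finset.sum_nbij' D.flip D.flip (fun t ht => flip_mem_triples ht)
        (fun t ht => flip_mem_triples ht) (fun t _ => D.flip_flip t) (fun t _ => D.flip_flip t)
        (fun t _ => by rw [flip_flip])
    -- Adding the expansion of `x` to its reindexing by `flip` pairs each `ξ_t` with `ε_t ξ_{flip
    -- t}`.
    have htwo : (2 : K) • x = ∑ t ∈ D.triples, D.coef t x • D.elt2 t := by
      rw [two_smul]
      nth_rewrite 1 [hsum]
      nth_rewrite 2 [hsum']
      rw [← Finset.sum_add_distrib]
      refine Finset.sum_congr rfl fun t ht => ?_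
      rw [elt2_eq, hxc t ht, smul_add, smul_smul, mul_comm]
    refine (Submodule.smul_mem_iff _ h2).1 ?_
    rw [htwo]
    refine Submodule.sum_mem _ fun t ht => ?_
    -- For a fixed triple `y_t = (1 + ε_t) ξ_t`, which is a multiple of an element of `S₀ ∪ S₁` or
    -- is zero.
    by_cases hf : D.flip t = t
    · have hst := D.flip_eq_self_iff.1 hf
      obtain ⟨i, j, k⟩ := t
      dsimp only at hst
      subst hst
      have hk : k < D.lam i := (mem_triples.1 ht).1
      by_cases h : (i, k) ∈ D.idx0 ∨ (i, k) ∈ D.idx1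
      · have hmem : D.xiOf (i, D.star i, k) ∈ Submodule.span K (D.S0 ∪ D.S1 ∪ D.S2) := by
          rw [← D.elt01_eq (i, k)]
          refine Submodule.subset_span (Or.inl ?_)
          exact h.imp (fun h => ⟨_, h, rfl⟩) (fun h => ⟨_, h, rfl⟩)
        rw [elt2_eq, hf]
        exact Submodule.smul_mem _ _ (Submodule.add_mem _ hmem (Submodule.smul_mem _ _ hmem))
      · push Not at h
        have hε := D.sgn_eq_neg_one hB hs hk h.1 h.2
        rw [elt2_eq, hf, hε, neg_smul, one_smul, add_neg_cancel, smul_zero]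
        exact zero_mem _
    · exact Submodule.smul_mem _ _
        (Submodule.subset_span (Or.inr ⟨t, D.mem_idx2_iff.2 ⟨ht, hf⟩, rfl⟩))

theorem span_range_family (hB : IsEvenSupersymmetric 𝒱 B)
    (he : ∀ u w, B (e u) w = -B u (e w)) {T : Set (Fin N × Fin N × ℕ)} (hT : D.IsTransversal T) :
    Submodule.span K (Set.range (D.family T)) = Submodule.span K (D.S0 ∪ D.S1 ∪ D.S2) := by
  apply le_antisymm
  · refine Submodule.span_mono ?_
    rintro _ ⟨(p | p) | t, rfl⟩
    · exact Or.inl (Or.inl ⟨p, p.2, rfl⟩)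
    · exact Or.inl (Or.inr ⟨p, p.2, rfl⟩)
    · exact Or.inr ⟨t, hT.1 t.2, rfl⟩
  · refine Submodule.span_le.2 ?_
    have hmem : ∀ t ∈ T, D.elt2 t ∈ Submodule.span K (Set.range (D.family T)) := fun t ht =>
      Submodule.subset_span ⟨Sum.inr ⟨t, ht⟩, rfl⟩
    rintro _ ((⟨p, hp, rfl⟩ | ⟨p, hp, rfl⟩) | ⟨t, ht, rfl⟩)
    · exact Submodule.subset_span ⟨Sum.inl (Sum.inl ⟨p, hp⟩), rfl⟩
    · exact Submodule.subset_span ⟨Sum.inl (Sum.inr ⟨p, hp⟩), rfl⟩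
    · rcases hT.2 t ht with h | h
      · exact hmem t h.1
      · rw [← D.flip_flip t, D.elt2_flip hB he]
        exact Submodule.smul_mem _ _ (hmem _ h.1)

/-- The triple whose coefficient detects a member of `family`. -/
def leading (T : Set (Fin N × Fin N × ℕ)) : (D.idx0 ⊕ D.idx1) ⊕ T → Fin N × Fin N × ℕ :=
  Sum.elim (Sum.elim (fun p => (p.1.1, D.star p.1.1, p.1.2)) fun p => (p.1.1, D.star p.1.1, p.1.2))
    Subtype.val

/-- The functionals `coef (leading s)` form a dual system: the second term of `y_t` sits at `flip
t`, which is neither in `T` nor fixed by `flip`, so no leading coordinate sees it. -/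
theorem linearIndependent_family (he : ∀ u w, B (e u) w = -B u (e w))
    {T : Set (Fin N × Fin N × ℕ)} (hT : D.IsTransversal T) :
    LinearIndependent K (D.family T) := by
  have hTt : ∀ t ∈ T, t ∈ D.triples := fun t ht => (D.mem_idx2_iff.1 (hT.1 ht)).1
  have hTf : ∀ t ∈ T, D.flip t ∉ T := fun t ht h => by
    rcases hT.2 t (hT.1 ht) with h' | h'
    · exact h'.2 h
    · exact h'.2 ht
  have hTs : ∀ t ∈ T, ∀ i k, t ≠ (i, D.star i, k) := by
    rintro t ht i k rfl
    exact (hT.1 ht).2 rfl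
  have hTfs : ∀ t ∈ T, ∀ i k, (i, D.star i, k) ≠ D.flip t := by
    rintro t ht i k h
    refine hTs t ht i k ?_
    rw [← D.flip_flip t, ← h]
    exact D.flip_eq_self_iff.2 rfl
  have h01 : ∀ p ∈ D.idx0, p ∉ D.idx1 := fun p h h' => by
    have := h.2.1.symm.trans h'.2.1
    exact absurd this (by decide)
  have hlead : ∀ s, D.leading T s ∈ D.triples := by
    rintro ((p | p) | t)
    · exact D.star_mem_triples p.2.1
    · exact D.star_mem_triples p.2.1
    · exact hTt t t.2
  refine LinearIndependent.of_pairwise_dual_eq_zero_one _ (fun s => D.coef (D.leading T s)) ?_ ?_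
  · rintro s s' hne
    have hl := hlead s
    rcases s' with (p | p) | t
    · refine (D.coef_elt01 he hl p.2.1).trans (if_neg fun h => hne ?_)
      rcases s with (q | q) | t
      · simp only [leading, Sum.elim_inl, Prod.mk.injEq] at h
        exact congrArg _ (congrArg _ (Subtype.ext (Prod.ext h.1 h.2.2)))
      · simp only [leading, Sum.elim_inl, Sum.elim_inr, Prod.mk.injEq] at h
        exact absurd q.2 (by rw [Prod.ext (x := q.1) h.1 h.2.2]; exact h01 _ p.2)
      · exact absurd h (hTs t t.2 _ _)
    · refine (D.coef_elt01 he hl p.2.1).trans (if_neg fun h => hne ?_)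
      rcases s with (q | q) | t
      · simp only [leading, Sum.elim_inl, Prod.mk.injEq] at h
        exact absurd p.2 (by rw [← Prod.ext (x := q.1) h.1 h.2.2]; exact h01 _ q.2)
      · simp only [leading, Sum.elim_inl, Sum.elim_inr, Prod.mk.injEq] at h
        exact congrArg _ (congrArg _ (Subtype.ext (Prod.ext h.1 h.2.2)))
      · exact absurd h (hTs t t.2 _ _)
    · refine (D.coef_elt2 he hl (hTt t t.2)).trans ?_
      rw [if_neg, if_neg, mul_zero, add_zero]
      · rcases s with (q | q) | t'
        · exact hTfs t t.2 _ _
        · exact hTfs t t.2 _ _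
        · intro h
          refine hTf t t.2 ?_
          rw [← h]
          exact t'.2
      · rcases s with (q | q) | t'
        · exact (hTs t t.2 _ _).symm
        · exact (hTs t t.2 _ _).symm
        · exact fun h => hne (congrArg _ (Subtype.ext h))
  · rintro ((p | p) | t)
    · exact (D.coef_elt01 he (hlead _) p.2.1).trans (if_pos rfl)
    · exact (D.coef_elt01 he (hlead _) p.2.1).trans (if_pos rfl)
    · refine (D.coef_elt2 he (hTt t t.2) (hTt t t.2)).trans ?_
      rw [if_pos rfl, if_neg (D.mem_idx2_iff.1 (hT.1 t.2)).2.symm, mul_zero, add_zero]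

end OspJordanData

theorem mainTheorem5 {K V : Type*} [Field K] [IsAlgClosed K] (hK : ringChar K ≠ 2)
    [AddCommGroup V] [Module K V] [FiniteDimensional K V]
    (𝒱 : ZMod 2 → Submodule K V) [DirectSum.Decomposition 𝒱]
    (B : LinearMap.BilinForm K V) (hB : IsEvenSupersymmetric 𝒱 B) (hB' : B.Nondegenerate)
    (e : Module.End K V) (he : e ∈ ospPart 𝒱 B 0) (hnil : IsNilpotent e) :
    (∃ N : ℕ, Nonempty (OspJordanData 𝒱 B e N)) ∧
    ∀ (N : ℕ) (D : OspJordanData 𝒱 B e N),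
      Submodule.span K (D.S0 ∪ D.S1 ∪ D.S2) = ospCentralizer 𝒱 B e ∧
      (∀ i j k, (i, j, k) ∈ D.idx2 →
        (D.star j, D.star i, k) ∈ D.idx2 ∧ (D.star j, D.star i, k) ≠ (i, j, k) ∧
        D.elt2 (D.star j, D.star i, k) = ((D.eps i j k : ℤ) : K) • D.elt2 (i, j, k)) ∧
      ∀ T : Set (Fin N × Fin N × ℕ), D.IsTransversal T →
        ∃ b : Module.Basis ((D.idx0 ⊕ D.idx1) ⊕ T) K (ospCentralizer 𝒱 B e),
          ∀ s, (b s : Module.End K V) = D.family T s := by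
  have h2 : (2 : K) ≠ 0 := Ring.two_ne_zero hK
  have hs := form_skew_of_mem_ospPart he
  refine ⟨exists_ospJordanData_of_mem_ospPart h2 𝒱 hB hB' he hnil, fun N D =>
    ⟨D.span_S h2 hB hB' he, fun i j k ht => ?_, fun T hT => ?_⟩⟩
  · exact ⟨D.flip_mem_idx2 ht, (D.mem_idx2_iff.1 ht).2, D.elt2_flip hB hs (i, j, k)⟩
  · refine ⟨(Basis.span (D.linearIndependent_family hs hT)).map (LinearEquiv.ofEq _ _
      ((D.span_range_family hB hs hT).trans (D.span_S h2 hB hB' he))), fun s => ?_⟩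
    rw [Basis.map_apply, LinearEquiv.coe_ofEq_apply, Basis.span_apply]
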